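/- **Theorem (the graded Euler characteristic of unoriented Khovanov homology).** Let $L$ be a virtual link, $D$ any diagram of $L$ (with labelled arcs), and $k$ an integral domain (for example $\mathbb Z$ or a field). Choose any orientation $o$ of $D$. Let $s_\pm$ be the number of positive/negative self-crossings of $D$, and $m$ the number of mixed crossings, i.e. classical crossings between different components (none of these depends on $o$). Put $(-1)^r=e^{i\pi r}$ for $r\in\mathbb Q$, so $(-1)^{1/2}=i$. *The unoriented Jones polynomial.* Let $K_1,\dots,K_\ell$ be the components of $L$, $Lk(K_i,K_j)$ half the sum of the signs of the crossings between $K_i$ and $K_j$, and $\pi(K_i,K_j)\in\{0,1\}$ the parity of the number of these crossings. The *core* of a sub-link is obtained by repeatedly deleting all components that have an odd number of mixed crossings within the current sub-link, until none is left. Let $C_1$ be the core of $L$, $C_2$ the core of $L\setminus C_1$, $C_3$ the core of $L\setminus(C_1\cup C_2)$, and so on. Put $p(K_i,K_j)=0$ if $K_i,K_j$ lie in the same $C_r$ and $p(K_i,K_j)=1$ otherwise, and $$\tilde\lambda=\sum_{i<j}(-1)^{p(K_i,K_j)\left(Lk(K_i,K_j)+\frac12\pi(K_i,K_j)\right)}Lk(K_i,K_j),\qquad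 \tilde J_L(q)=(-1)^{\tilde\lambda-s_--\frac12m}\,q^{\,s_+-2s_--\frac12m}\,\langle D\rangle ,$$ where the bracket $\langle D\rangle=\sum_\sigma(-q)^{n_B(\sigma)}(q+q^{-1})^{|\sigma|}$ is summed over all choices $\sigma$ of an $A$- or $B$-smoothing at each classical crossing, with $n_B(\sigma)$ $B$-smoothings and $|\sigma|$ circles. *Unoriented Khovanov homology.* $C(D)$ is the free $k$-module on the enhanced states (a state $\sigma$ with a label $1$ or $x$ on each circle); an enhanced state has homological degree $n_B$ and quantum degree $n_B+\#\{\text{labels }1\}-\#\{\text{labels }x\}$. The differential $\partial$ is the sum, over the crossings with an $A$-smoothing, of the maps that change it to a $B$-smoothing and act on the labels of the circles at that site by multiplication in $k[x]/(x^2)$ when two circles merge, by $\Delta(1)=1\otimes x+x\otimes1$, $\Delta(x)=x\otimes x$ when one circle splits, and by $0$ when one circle becomes one circle. Before and after acting, labels are transported along the circle between its base point (on its smallest arc) and the site, $x$ changing sign at each cut point; at each crossing, $o$ places one cut point on the outgoing under-end and one on the incoming over-end. Each map carries the sign of the permutations that move the circles involved (in the local order at the crossing: first the circle through the incoming under-end,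 then the one through the outgoing under-end) to the head of the list of circles, ordered by their smallest arcs, before the map and back to their places after it. Let $\tilde C(D)=C(D)[-s_--\frac12m]\{s_+-2s_--\frac12m\}$ ($[a]$ raises the homological and $\{b\}$ the quantum degree), let $\widetilde{Kh}^{i,j}(L)$, $i,j\in\frac12\mathbb Z$, be its homology, and $$\chi_q(\widetilde{Kh}(L))=\sum_{i,j\in\frac12\mathbb Z}(-1)^iq^j\operatorname{rank}_k\widetilde{Kh}^{i,j}(L).$$ Then $\partial^2=0$ and $\partial$ has bidegree $(1,0)$, $\tilde\lambda\in\frac12\mathbb Z$, and $$\tilde J_L(q)=(-1)^{\tilde\lambda}\,\chi_q(\widetilde{Kh}(L)),$$ and this holds even if three different orientations of $D$ are used to compute $\tilde J_L$, $(-1)^{\tilde\lambda}$ and $\widetilde{Kh}(L)$. -/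

import Mathlib

/-!
# Virtual link diagrams, the unoriented Jones polynomial and unoriented Khovanov homology
-/

/-- A labelled diagram of an unoriented virtual link, in PD (planar diagram) notation.
`n` is the number of classical crossings, and the arcs are labelled by `Fin N`.
At the crossing `c`, the arcs met when going counterclockwise around `c` are
`arc c 0, arc c 1, arc c 2, arc c 3`, where the slots `0` and `2` belong to the under-strand and
the slots `1` and `3` to the over-strand. Arcs run from classical crossing to classical crossing,
so an arc has two ends; an arc label that occurs at no crossing is a component without classical
crossings. Virtual crossings are not recorded. -/
structure VirtualDiagram where
  n : ℕ
  N : ℕ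
  arc : Fin n → Fin 4 → Fin N
  ends : ∀ a : Fin N,
    (Finset.univ.filter fun h : Fin n × Fin 4 => arc h.1 h.2 = a).card = 0 ∨
    (Finset.univ.filter fun h : Fin n × Fin 4 => arc h.1 h.2 = a).card = 2

namespace VirtualDiagram

/-- An orientation of (all components of) the link: `inward c p` says that the arc in slot `p` of
the crossing `c` points towards `c`. Strands go straight through crossings, and the two ends of an
arc are oriented coherently. -/
structure Orientation (D : VirtualDiagram) where
  inward : Fin D.n → Fin 4 → Bool
  straight : ∀ c p, inward c (p + 2) = !inward c p
  coherent : ∀ c p c' p', D.arc c p = D.arc c' p' → (c, p) ≠ (c', p') →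
    inward c' p' = !inward c p

noncomputable section

open scoped Classical

variable (D : VirtualDiagram)

/-! ### Components, crossing signs, linking numbers -/

/-- Two arcs lie on the same component of the link. -/
def SameComponent : Fin D.N → Fin D.N → Prop :=
  Relation.EqvGen fun a b => ∃ (c : Fin D.n) (p : Fin 4), a = D.arc c p ∧ b = D.arc c (p + 2)

/-- The components of the link, each represented by its smallest arc. -/
def components : Finset (Fin D.N) :=
  Finset.univ.filter fun a => ∀ b, D.SameComponent a b → a ≤ b

/-- The sign of a crossing: it is positive when the over-strand crosses the under-strand from
left to right. -/
def crossingSign {D : VirtualDiagram} (o : D.Orientation) (c : Fin D.n) : ℤ :=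
  if o.inward c 0 = o.inward c 3 then 1 else -1

/-- The crossing `c` is a self-crossing. -/
def IsSelf (c : Fin D.n) : Prop := D.SameComponent (D.arc c 0) (D.arc c 1)

/-- `s₊`, the number of positive self-crossings. -/
def sPlus {D : VirtualDiagram} (o : D.Orientation) : ℕ :=
  (Finset.univ.filter fun c => D.IsSelf c ∧ crossingSign o c = 1).card

/-- `s₋`, the number of negative self-crossings. -/
def sMinus {D : VirtualDiagram} (o : D.Orientation) : ℕ :=
  (Finset.univ.filter fun c => D.IsSelf c ∧ crossingSign o c = -1).card

/-- `m`, the number of mixed crossings. -/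
def mixedNumber : ℕ := (Finset.univ.filter fun c => ¬ D.IsSelf c).card

/-- The crossings between the component of the arc `i` and the component of the arc `j`. -/
def crossingsBetween (i j : Fin D.N) : Finset (Fin D.n) :=
  Finset.univ.filter fun c =>
    (D.SameComponent (D.arc c 0) i ∧ D.SameComponent (D.arc c 1) j) ∨
    (D.SameComponent (D.arc c 0) j ∧ D.SameComponent (D.arc c 1) i)

/-- The linking number `Lk(K_i, K_j)` of two different components, half the sum of the signs of
the crossings between them. -/
def linking {D : VirtualDiagram} (o : D.Orientation) (i j : Fin D.N) : ℚ :=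
  (∑ c ∈ D.crossingsBetween i j, (crossingSign o c : ℚ)) / 2

/-- The component-to-component parity `π(K_i, K_j)`. -/
def pairParity (i j : Fin D.N) : ℕ := (D.crossingsBetween i j).card % 2

/-! ### Cores and mantles -/

/-- The sub-link obtained from the sub-link with set of components `S` by deleting its odd
components, i.e. those with an odd number of mixed crossings within the sub-link. -/
def deleteOdd (S : Finset (Fin D.N)) : Finset (Fin D.N) :=
  S.filter fun i => Even (∑ j ∈ S.erase i, (D.crossingsBetween i j).card)

/-- The (even) core of the sub-link `S`: odd components are deleted until the result is even. Each
effective deletion removes a component, so `S.card` rounds suffice, and further ones do nothing. -/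
def core (S : Finset (Fin D.N)) : Finset (Fin D.N) := D.deleteOdd^[S.card] S

/-- The `r`-th mantle: `M₀` is the link itself and `M_{r+1} = M_r \ C_{r+1}`, where `C_{r+1}` is the
core of `M_r`. -/
def mantle (r : ℕ) : Finset (Fin D.N) := (fun M => M \ D.core M)^[r] D.components

/-- The component parity function `p(K_i, K_j)`: it is `0` if both components lie in the same core
`C_{r+1}` of the multi-core decomposition, and `1` otherwise. (When a mantle has empty core, all
later cores are empty.) -/
def coreParity (i j : Fin D.N) : ℤ :=
  if ∃ r, i ∈ D.core (D.mantle r) ∧ j ∈ D.core (D.mantle r) then 0 else 1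

/-- The modified linking number `(-1)^(p · (Lk + π / 2)) Lk`. The number `Lk + π / 2` is always an
integer; the floor only moves it to the type of integers. -/
def modifiedLinking {D : VirtualDiagram} (o : D.Orientation) (i j : Fin D.N) : ℚ :=
  (-1 : ℚ) ^ (D.coreParity i j * ⌊linking o i j + (D.pairParity i j : ℚ) / 2⌋) * linking o i j

/-- `λ̃`, the sum of the modified linking numbers over all pairs of different components. -/
def lambdaTilde {D : VirtualDiagram} (o : D.Orientation) : ℚ :=
  ∑ i ∈ D.components, ∑ j ∈ D.components.filter (fun j => i < j), modifiedLinking o i j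

/-! ### States -/

/-- The slot to which slot `p` is joined by the smoothing: `false` is the `A`-smoothing, joining
`0` with `1` and `2` with `3`; `true` is the `B`-smoothing, joining `0` with `3` and `1` with
`2`. -/
def partner : Bool → Fin 4 → Fin 4
  | false => ![1, 0, 3, 2]
  | true => ![3, 2, 1, 0]

/-- Two arcs lie on the same circle of the state `σ` (a choice of smoothing at each crossing). -/
def SameCircle (σ : Fin D.n → Bool) : Fin D.N → Fin D.N → Prop :=
  Relation.EqvGen fun a b =>
    ∃ (c : Fin D.n) (p : Fin 4), a = D.arc c p ∧ b = D.arc c (partner (σ c) p)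

/-- The circles of the state `σ`, each named after its smallest arc. -/
def circles (σ : Fin D.n → Bool) : Finset (Fin D.N) :=
  Finset.univ.filter fun a => ∀ b, D.SameCircle σ a b → a ≤ b

/-- The name of the circle through the arc `a`, i.e. the smallest arc of that circle; it also
carries the base point of the circle. -/
def circleOf (σ : Fin D.n → Bool) (a : Fin D.N) : Fin D.N :=
  (Finset.univ.filter fun b => D.SameCircle σ a b).min'
    ⟨a, Finset.mem_filter.2 ⟨Finset.mem_univ a, Relation.EqvGen.refl a⟩⟩

/-- The number of `B`-smoothings of a state. -/
def numB {D : VirtualDiagram} (σ : Fin D.n → Bool) : ℕ :=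
  (Finset.univ.filter fun c => σ c = true).card

/-! ### The bracket polynomial and the unoriented Jones polynomial

Polynomials in `q` with rational exponents and complex coefficients form the group algebra
`AddMonoidAlgebra ℂ ℚ`. -/

/-- The monomial `z q^r`. -/
def qMon (z : ℂ) (r : ℚ) : AddMonoidAlgebra ℂ ℚ := AddMonoidAlgebra.single r z

/-- The complex number `(-1)^r = exp(i π r)`, so that `(-1)^(1/2) = i`. -/
def negOnePow (r : ℚ) : ℂ := Complex.exp (Complex.I * Real.pi * (r : ℂ))

/-- The bracket polynomial, the solution of `⟨D⟩ = ⟨D_A⟩ - q ⟨D_B⟩` and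
`⟨O ∪ D⟩ = (q⁻¹ + q) ⟨D⟩`, as a sum over states. -/
def bracket : AddMonoidAlgebra ℂ ℚ :=
  ∑ σ : Fin D.n → Bool, (-qMon 1 1) ^ numB σ * (qMon 1 (-1) + qMon 1 1) ^ (D.circles σ).card

/-- The unoriented Jones polynomial, computed from the diagram `D` with an orientation. -/
def unorientedJones {D : VirtualDiagram} (o : D.Orientation) : AddMonoidAlgebra ℂ ℚ :=
  qMon (negOnePow (lambdaTilde o - sMinus o - (D.mixedNumber : ℚ) / 2))
      ((sPlus o : ℚ) - 2 * sMinus o - (D.mixedNumber : ℚ) / 2) * D.bracket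

/-! ### The bracket complex -/

/-- An enhanced state: a state together with a label `1` (`false`) or `x` (`true`) on each of its
circles. The label of a circle is recorded on all of its arcs. -/
structure EnhancedState where
  state : Fin D.n → Bool
  label : Fin D.N → Bool
  label_eq : ∀ c p, label (D.arc c p) = label (D.arc c (partner (state c) p))

variable {D}

/-- The quantum degree `j = n_B + r`, where `r` is the number of circles labelled `1` minus the
number of circles labelled `x`. -/
def EnhancedState.qDegree (s : D.EnhancedState) : ℤ :=
  numB s.state + ∑ a ∈ D.circles s.state, (if s.label a then -1 else 1)

/-- The slot of the incoming end of the under-strand. -/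
def underIn (o : D.Orientation) (c : Fin D.n) : Fin 4 := if o.inward c 0 then 0 else 2

/-- The slot of the outgoing end of the under-strand. -/
def underOut (o : D.Orientation) (c : Fin D.n) : Fin 4 := if o.inward c 0 then 2 else 0

/-- The arc of the incoming under-strand. -/
def arcIn (o : D.Orientation) (c : Fin D.n) : Fin D.N := D.arc c (underIn o c)

/-- The arc of the outgoing under-strand. -/
def arcOut (o : D.Orientation) (c : Fin D.n) : Fin D.N := D.arc c (underOut o c)

/-- There is a cut point near the crossing `c` on the end in slot `p` if that end is the outgoing
end of the under-strand or the incoming end of the over-strand. Reversing the orientation at the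
cut points gives the source-sink orientation in which under-strands point towards each crossing and
over-strands point away from it. -/
def IsCut (o : D.Orientation) (c : Fin D.n) (p : Fin 4) : Prop :=
  if p = 0 ∨ p = 2 then o.inward c p = false else o.inward c p = true

/-- The number of cut points at the end in slot `p`, modulo 2. -/
def cutParity (o : D.Orientation) (c : Fin D.n) (p : Fin 4) : ZMod 2 :=
  if IsCut o c p then 1 else 0

/-- `CutPath o σ (a, t) (b, t + e)`: there is a path along a circle of `σ` from the middle of the
arc `a` to the middle of the arc `b` passing a number of cut points that is `e` modulo 2. -/
def CutPath (o : D.Orientation) (σ : Fin D.n → Bool) :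
    Fin D.N × ZMod 2 → Fin D.N × ZMod 2 → Prop :=
  Relation.EqvGen fun x y => ∃ (c : Fin D.n) (p : Fin 4),
    x.1 = D.arc c p ∧ y.1 = D.arc c (partner (σ c) p) ∧
    y.2 = x.2 + cutParity o c p + cutParity o c (partner (σ c) p)

/-- The sign that `x` acquires when it is transported in the state `σ` between the base point of
the circle through the end in slot `p` of `c` and the site of the crossing `c`, reached through that
end: `-1` if the path passes an odd number of cut points, and `1` otherwise. -/
def transport (o : D.Orientation) (σ : Fin D.n → Bool) (c : Fin D.n) (p : Fin 4) : ℤ :=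
  if CutPath o σ (D.circleOf σ (D.arc c p), 0) (D.arc c p, cutParity o c p) then 1 else -1

/-- The sign of a transport applied to a label: `1 ↦ 1` and `x ↦ ± x`. -/
def labelSign (ε : ℤ) (b : Bool) : ℤ := if b then ε else 1

/-- The coefficient of `w` in the product `u · v` in `k[x]/(x²)`. -/
def mulCoeff (u v w : Bool) : ℤ := if (u && v) = false ∧ w = (u || v) then 1 else 0

/-- The coefficient of `v ⊗ w` in `Δ u`, where `Δ 1 = 1 ⊗ x + x ⊗ 1` and `Δ x = x ⊗ x`. -/
def comulCoeff (u v w : Bool) : ℤ :=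
  if u then (if v && w then 1 else 0) else (if xor v w then 1 else 0)

/-- The sign of the permutation moving `f` to the head of the increasingly ordered list of
circles. -/
def headSign (σ : Fin D.n → Bool) (f : Fin D.N) : ℤ :=
  (-1) ^ ((D.circles σ).filter fun a => a < f).card

/-- The sign of the permutation moving `f` to the first and `g` to the second place in the
increasingly ordered list of circles. -/
def headSign₂ (σ : Fin D.n → Bool) (f g : Fin D.N) : ℤ :=
  (-1) ^ (((D.circles σ).filter fun a => a < f).card +
    ((D.circles σ).filter fun a => a < g ∧ a ≠ f).card)

/-- The coefficient of `t` in the partial differential of `s` at the crossing `c`.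
It vanishes unless `t` arises from `s` by changing the smoothing at `c` from `A` to `B` and
relabelling only circles through the site `c`. At the site, the state `s` has a strand through the
incoming and a strand through the outgoing end of the under-strand, and so has `t`; the local order
puts the strand through the incoming end first. If these lie on two circles in `s`, the circles are
multiplied; if they lie on one circle in `s` and on two in `t`, the circle is comultiplied; if they
lie on one circle in both, the map is zero. -/
def partialCoeff (o : D.Orientation) (c : Fin D.n) (s t : D.EnhancedState) : ℤ :=
  if s.state c = false ∧ t.state = Function.update s.state c true ∧
      ∀ a, ¬ D.SameCircle s.state a (arcIn o c) → ¬ D.SameCircle s.state a (arcOut o c) →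
        t.label a = s.label a
  then
    if ¬ D.SameCircle s.state (arcIn o c) (arcOut o c) then
      headSign₂ s.state (D.circleOf s.state (arcIn o c)) (D.circleOf s.state (arcOut o c)) *
      headSign t.state (D.circleOf t.state (arcIn o c)) *
      labelSign (transport o s.state c (underIn o c)) (s.label (arcIn o c)) *
      labelSign (transport o s.state c (underOut o c)) (s.label (arcOut o c)) *
      labelSign (transport o t.state c (underIn o c)) (t.label (arcIn o c)) *
      mulCoeff (s.label (arcIn o c)) (s.label (arcOut o c)) (t.label (arcIn o c))
    else if ¬ D.SameCircle t.state (arcIn o c) (arcOut o c) then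
      headSign s.state (D.circleOf s.state (arcIn o c)) *
      headSign₂ t.state (D.circleOf t.state (arcIn o c)) (D.circleOf t.state (arcOut o c)) *
      labelSign (transport o s.state c (underIn o c)) (s.label (arcIn o c)) *
      labelSign (transport o t.state c (underIn o c)) (t.label (arcIn o c)) *
      labelSign (transport o t.state c (underOut o c)) (t.label (arcOut o c)) *
      comulCoeff (s.label (arcIn o c)) (t.label (arcIn o c)) (t.label (arcOut o c))
    else 0
  else 0

instance : Finite D.EnhancedState :=
  Finite.of_injective (fun s : D.EnhancedState => (s.state, s.label)) fun s t h => by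
    cases s; cases t; simpa using h

instance : Fintype D.EnhancedState := Fintype.ofFinite _

variable (k : Type*) [CommRing k]

/-- The differential of the bracket complex, whose underlying module is free on the enhanced
states: an enhanced state `s` is sent to the sum over all crossings `c` and all `t` of
`partialCoeff o c s t` times `t`. -/
def differential (o : D.Orientation) :
    (D.EnhancedState → k) →ₗ[k] (D.EnhancedState → k) :=
  Matrix.mulVecLin (Matrix.of fun t s => ((∑ c, partialCoeff o c s t : ℤ) : k))

variable (D) in
/-- `C^{i,j}(D)`, spanned by the enhanced states with `n_B = i` and quantum degree `j`. -/
def bracketChain (i j : ℚ) : Submodule k (D.EnhancedState → k) :=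
  Submodule.span k {f | ∃ s : D.EnhancedState,
    (numB s.state : ℚ) = i ∧ (s.qDegree : ℚ) = j ∧ f = Pi.single s 1}

/-- The unoriented Khovanov chain groups: the chain groups of
`C(D)[-s₋ - m/2]{s₊ - 2 s₋ - m/2}`. -/
def unorientedChain (o : D.Orientation) (i j : ℚ) : Submodule k (D.EnhancedState → k) :=
  bracketChain D k (i - (-(sMinus o : ℚ) - (D.mixedNumber : ℚ) / 2))
    (j - ((sPlus o : ℚ) - 2 * sMinus o - (D.mixedNumber : ℚ) / 2))

/-- The cycles of bidegree `(i, j)`. -/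
def cycles (o : D.Orientation) (i j : ℚ) : Submodule k (D.EnhancedState → k) :=
  LinearMap.ker (differential k o) ⊓ unorientedChain k o i j

/-- The boundaries of bidegree `(i, j)`. -/
def boundaries (o : D.Orientation) (i j : ℚ) : Submodule k (D.EnhancedState → k) :=
  (unorientedChain k o (i - 1) j).map (differential k o)

/-- The unoriented Khovanov homology in bidegree `(i, j)`. -/
abbrev UnorientedKh (o : D.Orientation) (i j : ℚ) : Type _ :=
  cycles k o i j ⧸ (boundaries k o i j).submoduleOf (cycles k o i j)

/-- The group of half-integers. -/
def halfIntegers : AddSubgroup ℚ := AddSubgroup.zmultiples (1 / 2)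

/-- The graded Euler characteristic of unoriented Khovanov homology, the sum of
`(-1)^i q^j dim Kh^{i,j}` over half-integers `i` and `j`. -/
def gradedEulerChar (o : D.Orientation) : AddMonoidAlgebra ℂ ℚ :=
  ∑ᶠ (i : halfIntegers) (j : halfIntegers),
    qMon (negOnePow i * (Module.finrank k (UnorientedKh k o i j) : ℂ)) j

end

end VirtualDiagram

namespace VirtualDiagram

noncomputable section

open scoped Classical

/-! ### Circles -/

section Circles

variable {D : VirtualDiagram}

/-! The identity is an instance of the Euler–Poincaré principle. Expanding every factor q + q⁻¹ over
the labels of a circle turns the bracket into a signed sum over enhanced states (`bracket_eq_sum`),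
and the prefactor of the Jones polynomial, apart from (-1)^λ̃, is exactly the degree shift of the
complex. Given ∂² = 0 and bidegree (1,0), rank–nullity over a domain writes the rank of a chain
group as the rank of homology plus the ranks of two boundary groups, and the boundary terms
telescope (`finrank_unorientedKh`, `gradedEulerChar_eq_sum`). What remains is ∂² = 0 and the
independence of the orientation.

For ∂² = 0 there is no planarity to use. Circles are studied through functions on arcs: unsigned
ones, constant on circles, and signed ones, which change along a circle like an orientation of it
compared with `o`. Summation by parts over the arcs pairs a signed f for one state with an unsigned
g for another; only the crossings where the states differ contribute, each by (f(in) + f(out))(g(in)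
- g(out)). Suitable choices of f and g yield all that is needed about merges, splits and one-to-one
changes.

The permutation signs live in an exterior algebra: contraction with g ↦ g(in) - g(out) sends the
wedge of the circles of a state to ± the wedge of the circles of the merged state
(`contractEnds_circleForm`), and contractions anticommute.

A label x is read as the value, at the base point of its circle, of a signed function F with
square-zero values; transport through cut points is then precisely the variation of F along the
circle. Pulled back along an edge, this evaluation is multiplied by the edge sign and by 1 for a
merge or F(in) - F(out) for a split (`sum_partialCoeff_mul_evalState`). Every face thus reduces to
an identity between signs and factors (`IsFace.anticommute`), and a universal F with values in
ℤ[X_K]/(X_K²) detects every coefficient (`exists_universal_signed`).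

As to the orientation, signs of self-crossings never change. Reversing components changes λ̃ by an
even integer: for a pair not in a common core the sign in the modified linking number makes the
change even, and within a core the changes add up to crossing numbers of components of an even link
(`negOnePow_lambdaTilde_eq`). -/

theorem SameCircle.refl (σ : Fin D.n → Bool) (a : Fin D.N) : D.SameCircle σ a a :=
  Relation.EqvGen.refl a

theorem SameCircle.symm {σ : Fin D.n → Bool} {a b : Fin D.N} (h : D.SameCircle σ a b) :
    D.SameCircle σ b a :=
  Relation.EqvGen.symm _ _ h

theorem SameCircle.trans {σ : Fin D.n → Bool} {a b c : Fin D.N} (h : D.SameCircle σ a b)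
    (h' : D.SameCircle σ b c) : D.SameCircle σ a c :=
  Relation.EqvGen.trans _ _ _ h h'

theorem sameCircle_partner (σ : Fin D.n → Bool) (c : Fin D.n) (p : Fin 4) :
    D.SameCircle σ (D.arc c p) (D.arc c (partner (σ c) p)) :=
  Relation.EqvGen.rel _ _ ⟨c, p, rfl, rfl⟩

/-- A function that is invariant under the smoothings is constant on circles. -/
theorem SameCircle.apply_eq {σ : Fin D.n → Bool} {X : Type*} {g : Fin D.N → X}
    (hg : ∀ c p, g (D.arc c p) = g (D.arc c (partner (σ c) p))) {a b : Fin D.N}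
    (h : D.SameCircle σ a b) : g a = g b := by
  induction h with
  | rel x y h => obtain ⟨c, p, rfl, rfl⟩ := h; exact hg c p
  | refl x => rfl
  | symm x y _ ih => exact ih.symm
  | trans x y z _ _ ih₁ ih₂ => exact ih₁.trans ih₂

theorem sameCircle_circleOf (σ : Fin D.n → Bool) (a : Fin D.N) :
    D.SameCircle σ a (D.circleOf σ a) := by
  have := Finset.min'_mem (Finset.univ.filter fun b => D.SameCircle σ a b)
    ⟨a, Finset.mem_filter.2 ⟨Finset.mem_univ a, Relation.EqvGen.refl a⟩⟩
  exact (Finset.mem_filter.1 this).2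

theorem circleOf_le {σ : Fin D.n → Bool} {a b : Fin D.N} (h : D.SameCircle σ a b) :
    D.circleOf σ a ≤ b :=
  Finset.min'_le _ _ (Finset.mem_filter.2 ⟨Finset.mem_univ b, h⟩)

theorem circleOf_eq_iff {σ : Fin D.n → Bool} {a b : Fin D.N} :
    D.circleOf σ a = D.circleOf σ b ↔ D.SameCircle σ a b := by
  constructor
  · intro h
    have := sameCircle_circleOf σ a
    rw [h] at this
    exact this.trans (sameCircle_circleOf σ b).symm
  · intro h
    exact le_antisymm (circleOf_le (h.trans (sameCircle_circleOf σ b)))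
      (circleOf_le (h.symm.trans (sameCircle_circleOf σ a)))

theorem mem_circles_iff {σ : Fin D.n → Bool} {a : Fin D.N} :
    a ∈ D.circles σ ↔ D.circleOf σ a = a := by
  simp only [circles, Finset.mem_filter, Finset.mem_univ, true_and]
  constructor
  · intro h
    exact le_antisymm (circleOf_le (SameCircle.refl σ a)) (h _ (sameCircle_circleOf σ a))
  · intro h b hb
    rw [← h]
    exact circleOf_le hb

theorem circleOf_mem_circles (σ : Fin D.n → Bool) (a : Fin D.N) :
    D.circleOf σ a ∈ D.circles σ :=
  mem_circles_iff.2 (circleOf_eq_iff.2 (sameCircle_circleOf σ a).symm)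

theorem circleOf_partner (σ : Fin D.n → Bool) (c : Fin D.n) (p : Fin 4) :
    D.circleOf σ (D.arc c p) = D.circleOf σ (D.arc c (partner (σ c) p)) :=
  circleOf_eq_iff.2 (sameCircle_partner σ c p)

/-- Two states that differ exactly at the crossing `c`. -/
def Adjacent (c : Fin D.n) (σ σ' : Fin D.n → Bool) : Prop :=
  σ c ≠ σ' c ∧ ∀ x, x ≠ c → σ x = σ' x

theorem Adjacent.symm {c : Fin D.n} {σ σ' : Fin D.n → Bool} (h : Adjacent c σ σ') :
    Adjacent c σ' σ :=
  ⟨h.1.symm, fun x hx => (h.2 x hx).symm⟩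

theorem partner_partner (b : Bool) (p : Fin 4) : partner b (partner b p) = p := by
  cases b <;> fin_cases p <;> rfl

theorem partner_ne (b : Bool) (p : Fin 4) : partner b p ≠ p := by
  cases b <;> fin_cases p <;> decide

end Circles

/-! ### Signed functions and the pairing with functions on circles -/

section Pairing

variable {D : VirtualDiagram} (o : D.Orientation) {B : Type*} [CommRing B]

/-- The value of `f` at the end in slot `p` of `c`, with the sign of the orientation at that end. -/
def endValue (f : Fin D.N → B) (c : Fin D.n) (p : Fin 4) : B :=
  if o.inward c p then f (D.arc c p) else -f (D.arc c p)

/-- A function on arcs that transforms under the smoothings like an orientation of the circles. -/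
def IsSigned (σ : Fin D.n → Bool) (f : Fin D.N → B) : Prop :=
  ∀ c p, endValue o f c (partner (σ c) p) = -endValue o f c p

/-- A function on arcs that is constant on circles. -/
def IsUnsigned {X : Type*} (σ : Fin D.n → Bool) (g : Fin D.N → X) : Prop :=
  ∀ c p, g (D.arc c p) = g (D.arc c (partner (σ c) p))

/-- Summation by parts: the two ends of an arc carry opposite orientation signs, so after regrouping
by arcs everything cancels. This is the only place where the global shape of the diagram enters the
pairing. -/
theorem sum_endValue_mul (f g : Fin D.N → B) :
    ∑ c, ∑ p, endValue o f c p * g (D.arc c p) = 0 := by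
  rw [← Fintype.sum_prod_type' (f := fun c p => endValue o f c p * g (D.arc c p)),
    ← Finset.sum_fiberwise Finset.univ (fun h : Fin D.n × Fin 4 => D.arc h.1 h.2)]
  refine Finset.sum_eq_zero fun a _ => ?_
  rcases D.ends a with h | h
  · rw [Finset.card_eq_zero] at h
    have : (Finset.univ.filter fun h : Fin D.n × Fin 4 => D.arc h.1 h.2 = a) = ∅ := by
      convert h
    rw [this, Finset.sum_empty]
  · obtain ⟨⟨c, p⟩, ⟨c', p'⟩, hne, he⟩ := Finset.card_eq_two.1 h
    have : (Finset.univ.filter fun h : Fin D.n × Fin 4 => D.arc h.1 h.2 = a) =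
        {(c, p), (c', p')} := by
      convert he
    have h₁ : D.arc c p = a := by
      have : (c, p) ∈ ({(c, p), (c', p')} : Finset (Fin D.n × Fin 4)) := by simp
      rw [← he] at this; simpa using this
    have h₂ : D.arc c' p' = a := by
      have : (c', p') ∈ ({(c, p), (c', p')} : Finset (Fin D.n × Fin 4)) := by simp
      rw [← he] at this; simpa using this
    rw [this, Finset.sum_pair hne]
    have := o.coherent c p c' p' (h₁.trans h₂.symm) hne
    simp only [endValue, h₁, h₂, this]
    cases o.inward c p <;> simp

theorem endValue_underIn (f : Fin D.N → B) (c : Fin D.n) :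
    endValue o f c (underIn o c) = f (arcIn o c) := by
  have h2 := o.straight c 0
  rw [zero_add] at h2
  unfold endValue arcIn underIn
  cases h : o.inward c 0 <;> simp_all

theorem endValue_underOut (f : Fin D.N → B) (c : Fin D.n) :
    endValue o f c (underOut o c) = -f (arcOut o c) := by
  have h2 := o.straight c 0
  rw [zero_add] at h2
  unfold endValue arcOut underOut
  cases h : o.inward c 0 <;> simp_all

theorem endValue_under_mul (f g : Fin D.N → B) (c : Fin D.n) :
    (endValue o f c 0 - endValue o f c 2) * (g (D.arc c 0) - g (D.arc c 2)) =
      (f (arcIn o c) + f (arcOut o c)) * (g (arcIn o c) - g (arcOut o c)) := by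
  have h2 := o.straight c 0
  rw [zero_add] at h2
  unfold endValue arcIn arcOut underIn underOut
  cases h : o.inward c 0
  · simp [h, h2]; ring
  · simp [h, h2]

variable {o}

/-- Joined ends carry opposite values of f and equal values of g, so they cancel in pairs. -/
theorem sum_endValue_mul_of_eq {σ σ' : Fin D.n → Bool} {f g : Fin D.N → B}
    (hf : IsSigned o σ f) (hg : IsUnsigned σ' g) {c : Fin D.n} (h : σ c = σ' c) :
    ∑ p, endValue o f c p * g (D.arc c p) = 0 := by
  have h0 := hf c 0
  have h2 := hf c 2
  have g0 := hg c 0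
  have g2 := hg c 2
  rw [h] at h0 h2
  rw [Fin.sum_univ_four]
  cases hb : σ' c <;> simp only [hb, partner] at h0 h2 g0 g2 <;> simp at h0 h2 g0 g2 <;>
    (rw [h0, h2, g0, g2]; ring)

/-- The values of f on the over-ends are determined by the under-ends through one pairing and those
of g through the other, so the four terms factor as a product over the two under-ends. -/
theorem sum_endValue_mul_of_ne {σ σ' : Fin D.n → Bool} {f g : Fin D.N → B}
    (hf : IsSigned o σ f) (hg : IsUnsigned σ' g) {c : Fin D.n} (h : σ c ≠ σ' c) :
    ∑ p, endValue o f c p * g (D.arc c p) =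
      (f (arcIn o c) + f (arcOut o c)) * (g (arcIn o c) - g (arcOut o c)) := by
  rw [← endValue_under_mul]
  have h0 := hf c 0
  have h2 := hf c 2
  have g0 := hg c 0
  have g2 := hg c 2
  rw [Fin.sum_univ_four]
  cases hb : σ c <;> cases hb' : σ' c <;> simp only [hb, hb', partner] at h h0 h2 g0 g2 <;>
    simp at h h0 h2 g0 g2 <;> (rw [h0, h2, ← g0, ← g2]; ring)

/-- All crossings but `c` contribute nothing to the total sum. Evaluating this on well-chosen f and
g replaces topological arguments about surgery on circles. -/
theorem pairing_adjacent {c : Fin D.n} {σ σ' : Fin D.n → Bool} (h : Adjacent c σ σ')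
    {f g : Fin D.N → B} (hf : IsSigned o σ f) (hg : IsUnsigned σ' g) :
    (f (arcIn o c) + f (arcOut o c)) * (g (arcIn o c) - g (arcOut o c)) = 0 := by
  rw [← sum_endValue_mul_of_ne hf hg h.1, ← sum_endValue_mul o f g]
  symm
  exact Finset.sum_eq_single c (fun x _ hx => sum_endValue_mul_of_eq hf hg (h.2 x hx)) (by simp)

theorem pairing_two {c d : Fin D.n} (hcd : c ≠ d) {σ σ' : Fin D.n → Bool} (hc : σ c ≠ σ' c)
    (hd : σ d ≠ σ' d) (h : ∀ x, x ≠ c → x ≠ d → σ x = σ' x)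
    {f g : Fin D.N → B} (hf : IsSigned o σ f) (hg : IsUnsigned σ' g) :
    (f (arcIn o c) + f (arcOut o c)) * (g (arcIn o c) - g (arcOut o c)) +
      (f (arcIn o d) + f (arcOut o d)) * (g (arcIn o d) - g (arcOut o d)) = 0 := by
  rw [← sum_endValue_mul_of_ne hf hg hc, ← sum_endValue_mul_of_ne hf hg hd,
    ← sum_endValue_mul o f g]
  symm
  rw [← Finset.sum_pair hcd (f := fun c => ∑ p, endValue o f c p * g (D.arc c p))]
  refine (Finset.sum_subset (Finset.subset_univ _) fun x _ hx => ?_).symm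
  simp only [Finset.mem_insert, Finset.mem_singleton, not_or] at hx
  exact sum_endValue_mul_of_eq hf hg (h x hx.1 hx.2)

end Pairing

/-! ### Existence of signed functions -/

/-- The orbits of the two involutions are cycles or lines along which α and β alternate; each splits
into two orbits of φ = αβ, exchanged by α and by β. The function is the indicator of one of these
minus the indicator of the other. -/
theorem exists_alternating_of_involutions {H : Type*} (α β : Equiv.Perm H) (hα : α * α = 1)
    (hβ : β * β = 1) (fα : ∀ h, α h ≠ h) (fβ : ∀ h, β h ≠ h) (h₀ : H) :
    ∃ F : H → ℤ, F h₀ = 1 ∧ (∀ h, F (α h) = -F h) ∧ ∀ h, F (β h) = -F h := by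
  set φ := α * β with hφ
  have iα : α⁻¹ = α := inv_eq_of_mul_eq_one_left hα
  have iβ : β⁻¹ = β := inv_eq_of_mul_eq_one_left hβ
  have hinv : φ⁻¹ = β * α := by rw [hφ, mul_inv_rev, iα, iβ]
  have hs : SemiconjBy α φ φ⁻¹ := by
    unfold SemiconjBy
    rw [hinv, hφ, mul_assoc, hα, mul_one, ← mul_assoc, hα, one_mul]
  have hz : ∀ (n : ℤ) h, α ((φ ^ n) h) = (φ ^ (-n)) (α h) := fun n h => by
    have := hs.zpow_right n
    rw [inv_zpow'] at this
    exact congrArg (fun e : Equiv.Perm H => e h) this.eq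
  -- If φⁿ h = α h, then the midpoint φᵐ h is fixed by α when n = 2m and by β when n = 2m + 1.
  have key : ∀ h, ¬ φ.SameCycle h (α h) := by
    rintro h ⟨n, hn⟩
    obtain ⟨m, rfl | rfl⟩ := Int.even_or_odd' n
    · apply fα ((φ ^ m) h)
      rw [hz, ← hn, ← Equiv.Perm.mul_apply, ← zpow_add]
      congr 2; ring
    · apply fβ ((φ ^ m) h)
      apply α.injective
      rw [hz, ← hn, ← Equiv.Perm.mul_apply α β, ← hφ, ← Equiv.Perm.mul_apply,
        ← Equiv.Perm.mul_apply, ← zpow_add, ← zpow_one_add]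
      congr 2; ring
  have hαα : ∀ h, α (α h) = h := fun h => by
    rw [← Equiv.Perm.mul_apply, hα, Equiv.Perm.one_apply]
  refine ⟨fun h => (if φ.SameCycle h₀ h then 1 else 0) - (if φ.SameCycle h₀ (α h) then 1 else 0),
    ?_, ?_, ?_⟩
  · simp [key h₀, Equiv.Perm.SameCycle.refl]
  · intro h
    simp only [hαα]; ring
  · intro h
    have e₁ : φ.SameCycle h₀ (α (β h)) ↔ φ.SameCycle h₀ h :=
      Equiv.Perm.sameCycle_apply_right (f := φ)
    have e₂ : φ.SameCycle h₀ (β h) ↔ φ.SameCycle h₀ (α h) := by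
      have : α h = φ (β h) := by
        rw [hφ, Equiv.Perm.mul_apply, ← Equiv.Perm.mul_apply β β, hβ, Equiv.Perm.one_apply]
      rw [this, Equiv.Perm.sameCycle_apply_right]
    simp only [e₁, e₂]; ring

section Existence

variable {D : VirtualDiagram} (o : D.Orientation)

theorem exists_otherEnd (h : Fin D.n × Fin 4) : ∃ h' : Fin D.n × Fin 4, h' ≠ h ∧
    D.arc h'.1 h'.2 = D.arc h.1 h.2 ∧
    ∀ h'' : Fin D.n × Fin 4, D.arc h''.1 h''.2 = D.arc h.1 h.2 → h'' = h ∨ h'' = h' := by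
  have hm : h ∈ Finset.univ.filter fun x : Fin D.n × Fin 4 => D.arc x.1 x.2 = D.arc h.1 h.2 := by
    simp
  rcases D.ends (D.arc h.1 h.2) with h0 | h2
  · rw [Finset.card_eq_zero] at h0
    simp [h0] at hm
  · obtain ⟨x, y, hxy, he⟩ := Finset.card_eq_two.1 h2
    have hall : ∀ z : Fin D.n × Fin 4, D.arc z.1 z.2 = D.arc h.1 h.2 ↔ z = x ∨ z = y := by
      intro z
      have := Finset.ext_iff.1 he z
      simpa using this
    rcases (hall h).1 rfl with rfl | rfl
    · exact ⟨y, hxy.symm, (hall y).2 (Or.inr rfl), fun z hz => (hall z).1 hz⟩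
    · exact ⟨x, hxy, (hall x).2 (Or.inl rfl), fun z hz => ((hall z).1 hz).symm⟩

/-- For every way of joining the ends at each crossing in pairs there is a function that transforms
like an orientation of the resulting circles and does not vanish at a given arc. -/
theorem exists_signed (β : Fin D.n → Fin 4 → Fin 4) (hβ : ∀ c p, β c (β c p) = p)
    (fβ : ∀ c p, β c p ≠ p) (a₀ : Fin D.N) :
    ∃ f : Fin D.N → ℤ, f a₀ = 1 ∧ ∀ c p, endValue o f c (β c p) = -endValue o f c p := by
  by_cases h : ∃ h₀ : Fin D.n × Fin 4, D.arc h₀.1 h₀.2 = a₀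
  · obtain ⟨h₀, hh₀⟩ := h
    choose α hα₁ hα₂ hα₃ using exists_otherEnd (D := D)
    have hαα : Function.Involutive α := fun h =>
      (hα₃ h (α (α h)) ((hα₂ _).trans (hα₂ _))).resolve_right (hα₁ _)
    have hβ' : Function.Involutive fun h : Fin D.n × Fin 4 => (h.1, β h.1 h.2) :=
      fun h => Prod.ext rfl (hβ _ _)
    obtain ⟨F, hF₀, hFα, hFβ⟩ := exists_alternating_of_involutions hαα.toPerm hβ'.toPerm
      (Equiv.ext fun h => hαα h) (Equiv.ext fun h => hβ' h) hα₁
      (fun h e => fβ h.1 h.2 (congrArg Prod.snd e)) h₀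
    let G : Fin D.n × Fin 4 → ℤ := fun h => if o.inward h.1 h.2 then F h else -F h
    have hG : ∀ h h' : Fin D.n × Fin 4, D.arc h.1 h.2 = D.arc h'.1 h'.2 → G h = G h' := by
      intro h h' e
      rcases hα₃ h h' e.symm with rfl | rfl
      · rfl
      · have h1 := o.coherent h.1 h.2 (α h).1 (α h).2 e (fun e' => hα₁ h e'.symm)
        have h2 : F (α h) = -F h := hFα h
        simp only [G, h1, h2]
        cases o.inward h.1 h.2 <;> simp
    let f : Fin D.N → ℤ := fun a =>
      if h : ∃ h : Fin D.n × Fin 4, D.arc h.1 h.2 = a then G h.choose else 0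
    have hf : ∀ h : Fin D.n × Fin 4, f (D.arc h.1 h.2) = G h := by
      intro h
      have hex : ∃ h' : Fin D.n × Fin 4, D.arc h'.1 h'.2 = D.arc h.1 h.2 := ⟨h, rfl⟩
      simp only [f, dif_pos hex]
      exact hG _ _ hex.choose_spec
    have hv : ∀ c p, endValue o f c p = F (c, p) := by
      intro c p
      have := hf (c, p)
      simp only at this
      simp only [endValue, this, G]
      cases o.inward c p <;> simp
    have hsol : ∀ c p, endValue o f c (β c p) = -endValue o f c p := by
      intro c p
      rw [hv, hv]
      exact hFβ (c, p)
    have hfa : f a₀ = 1 ∨ f a₀ = -1 := by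
      rw [← hh₀, hf]
      simp only [G, hF₀]
      cases o.inward h₀.1 h₀.2 <;> simp
    rcases hfa with hfa | hfa
    · exact ⟨f, hfa, hsol⟩
    · refine ⟨fun a => -f a, by simp [hfa], fun c p => ?_⟩
      have := hsol c p
      simp only [endValue] at this ⊢
      split_ifs at this ⊢ <;> linarith
  · refine ⟨fun a => if a = a₀ then 1 else 0, by simp, fun c p => ?_⟩
    have : ∀ c p, D.arc c p ≠ a₀ := fun c p e => h ⟨(c, p), e⟩
    simp [endValue, this]

end Existence

/-! ### Merging and splitting circles -/

section Surgery

variable {D : VirtualDiagram} {o : D.Orientation} {B : Type*} [CommRing B]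

theorem isSigned_mul_isUnsigned {σ : Fin D.n → Bool} {f g : Fin D.N → B} (hf : IsSigned o σ f)
    (hg : IsUnsigned σ g) : IsSigned o σ fun a => f a * g a := by
  intro c p
  have h := hf c p
  have h' := hg c p
  simp only [endValue] at h ⊢
  rw [← h']
  split_ifs at h ⊢ <;> linear_combination g (D.arc c p) * h

theorem isUnsigned_signed_mul_signed {σ : Fin D.n → Bool} {f f' : Fin D.N → B}
    (hf : IsSigned o σ f) (hf' : IsSigned o σ f') : IsUnsigned σ fun a => f a * f' a := by
  intro c p
  have h := hf c p
  have h' := hf' c p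
  have key : ∀ q, f (D.arc c q) * f' (D.arc c q) = endValue o f c q * endValue o f' c q := by
    intro q
    simp only [endValue]
    split_ifs <;> ring
  simp only [key, h, h']
  ring

theorem IsUnsigned.eq {X : Type*} {σ : Fin D.n → Bool} {g : Fin D.N → X} (hg : IsUnsigned σ g)
    {a b : Fin D.N} (h : D.SameCircle σ a b) : g a = g b :=
  h.apply_eq hg

variable (B) in
/-- The indicator function of the circle through the arc `a`. -/
def circleIndicator (σ : Fin D.n → Bool) (a b : Fin D.N) : B :=
  if D.SameCircle σ a b then 1 else 0

variable (B) in
theorem isUnsigned_circleIndicator (σ : Fin D.n → Bool) (a : Fin D.N) :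
    IsUnsigned σ (circleIndicator B σ a) := by
  intro c p
  have : D.SameCircle σ a (D.arc c p) ↔ D.SameCircle σ a (D.arc c (partner (σ c) p)) :=
    ⟨fun h => h.trans (sameCircle_partner σ c p), fun h => h.trans (sameCircle_partner σ c p).symm⟩
  simp only [circleIndicator, this]

variable (o) in
theorem exists_isSigned (σ : Fin D.n → Bool) (a : Fin D.N) :
    ∃ f : Fin D.N → ℤ, f a = 1 ∧ IsSigned o σ f :=
  exists_signed o (fun c => partner (σ c)) (fun _ _ => partner_partner _ _)
    (fun _ _ => partner_ne _ _) a

/-- Pair an orientation of the single circle of σ through the incoming end with the indicator of the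
circle of σ' through that end: the first factor is 1, so the second one vanishes. -/
theorem sameCircle_of_not_sameCircle {c : Fin D.n} {σ σ' : Fin D.n → Bool} (h : Adjacent c σ σ')
    (hn : ¬ D.SameCircle σ (arcIn o c) (arcOut o c)) :
    D.SameCircle σ' (arcIn o c) (arcOut o c) := by
  obtain ⟨f, hf₁, hf⟩ := exists_isSigned o σ (arcIn o c)
  have := pairing_adjacent h (isSigned_mul_isUnsigned hf
    (isUnsigned_circleIndicator ℤ σ (arcIn o c))) (isUnsigned_circleIndicator ℤ σ' (arcIn o c))
  by_contra hn'
  simp [circleIndicator, hn, hn', hf₁, SameCircle.refl] at this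

/-- The indicator of one of the two circles about to merge has difference 1 at the crossing, which
forces the other factor of the pairing to vanish. -/
theorem add_eq_zero_of_not_sameCircle {c : Fin D.n} {σ σ' : Fin D.n → Bool}
    (h : Adjacent c σ σ') (hn : ¬ D.SameCircle σ (arcIn o c) (arcOut o c)) {f : Fin D.N → B}
    (hf : IsSigned o σ' f) : f (arcIn o c) + f (arcOut o c) = 0 := by
  have := pairing_adjacent h.symm hf (isUnsigned_circleIndicator B σ (arcIn o c))
  simpa [circleIndicator, hn, SameCircle.refl] using this

theorem endValue_zero_two (f : Fin D.N → B) (c : Fin D.n) :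
    (endValue o f c 0 = f (arcIn o c) ∧ endValue o f c 2 = -f (arcOut o c)) ∨
      (endValue o f c 0 = -f (arcOut o c) ∧ endValue o f c 2 = f (arcIn o c)) := by
  have h₁ := endValue_underIn o f c
  have h₂ := endValue_underOut o f c
  unfold underIn at h₁
  unfold underOut at h₂
  split_ifs at h₁ h₂
  · exact Or.inl ⟨h₁, h₂⟩
  · exact Or.inr ⟨h₂, h₁⟩

/-- If all ends at a crossing are opposite in sign for opposite strands, a signed function stays
signed when the smoothing is changed. -/
theorem isSigned_adjacent {c : Fin D.n} {σ σ' : Fin D.n → Bool} (h : Adjacent c σ σ')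
    {f : Fin D.N → B} (hf : IsSigned o σ f) (h0 : f (arcIn o c) + f (arcOut o c) = 0) :
    IsSigned o σ' f := by
  intro x p
  by_cases hx : x = c
  · subst hx
    have e : endValue o f x 0 = endValue o f x 2 := by
      rcases endValue_zero_two (o := o) f x with ⟨h₁, h₂⟩ | ⟨h₁, h₂⟩ <;> rw [h₁, h₂]
      · linear_combination h0
      · linear_combination -h0
    have h0 := hf x 0
    have h2 := hf x 2
    have hne := h.1
    cases hb : σ x <;> cases hb' : σ' x <;> simp only [hb, hb', partner] at hne h0 h2 ⊢ <;>
      simp at hne h0 h2 <;> fin_cases p <;> simp [h0, h2, e]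
  · rw [← h.2 x hx]
    exact hf x p

/-- An orientation f of the common circle takes the values 1 and ±1 at the two under-ends. With
equal values the claim follows because F · f is unsigned. Opposite values would make f signed for
both smoothings, which is refuted by comparison with a third way of joining the ends at `c`. -/
theorem eq_of_sameCircle_of_sameCircle {c : Fin D.n} {σ σ' : Fin D.n → Bool} (h : Adjacent c σ σ')
    (hs : D.SameCircle σ (arcIn o c) (arcOut o c))
    (hs' : D.SameCircle σ' (arcIn o c) (arcOut o c)) {F : Fin D.N → B}
    (hF : IsSigned o σ F) : F (arcIn o c) = F (arcOut o c) := by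
  obtain ⟨f, hf₁, hf⟩ := exists_isSigned o σ (arcIn o c)
  have hsq : f (arcIn o c) * f (arcIn o c) = f (arcOut o c) * f (arcOut o c) :=
    (isUnsigned_signed_mul_signed hf hf).eq hs
  rw [hf₁] at hsq
  have hcases : f (arcOut o c) = 1 ∨ f (arcOut o c) = -1 :=
    mul_self_eq_one_iff.1 (by linarith)
  rcases hcases with h1 | h1
  · have hf' : IsSigned o σ fun a => (f a : B) := by
      intro x p
      have := hf x p
      simp only [endValue] at this ⊢
      split_ifs at this ⊢ <;> exact_mod_cast congrArg (Int.cast : ℤ → B) this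
    have := (isUnsigned_signed_mul_signed hF hf').eq hs
    simpa [hf₁, h1] using this
  · exfalso
    have hsum : f (arcIn o c) + f (arcOut o c) = 0 := by rw [hf₁, h1]; rfl
    have hf' := isSigned_adjacent h hf hsum
    -- The third joining lets the strands go straight through `c`, as at a virtual crossing; here k
    -- takes the same value 1 at both under-ends.
    obtain ⟨k, hk₁, hk⟩ := exists_signed o
      (fun x => if x = c then fun p => p + 2 else partner (σ x))
      (fun x p => by
        by_cases hx : x = c
        · simp only [hx, if_true]; fin_cases p <;> rfl
        · simp only [hx, if_false]; exact partner_partner _ _)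
      (fun x p => by
        by_cases hx : x = c
        · simp only [hx, if_true]; fin_cases p <;> decide
        · simp only [hx, if_false]; exact partner_ne _ _) (arcIn o c)
    have hkc : ∀ p, endValue o k c (p + 2) = -endValue o k c p := fun p => by
      have := hk c p
      simpa using this
    have hsqk : ∀ x p, k (D.arc x p) * k (D.arc x p) = endValue o k x p * endValue o k x p := by
      intro x p
      simp only [endValue]
      split_ifs <;> ring
    -- Away from `c` the square k² is unsigned for σ, so in the pairing with f only `c` survives.
    -- Since f is 1 at the under-ends and -1 at the over-ends, k² agrees on the two strands.
    have hpair : ∑ p, endValue o f c p * (k (D.arc c p) * k (D.arc c p)) = 0 := by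
      rw [← sum_endValue_mul o f (fun a => k a * k a)]
      symm
      refine Finset.sum_eq_single c (fun x _ hx => ?_) (by simp)
      have k0 := hk x 0
      have k2 := hk x 2
      have f0 := hf x 0
      have f2 := hf x 2
      simp only [hx, if_false] at k0 k2
      rw [Fin.sum_univ_four]
      simp only [hsqk]
      cases hb : σ x <;> simp only [hb, partner] at k0 k2 f0 f2 <;> simp at k0 k2 f0 f2 <;>
        (rw [k0, k2, f0, f2]; ring)
    have k0 := hkc 0
    have k1 := hkc 1
    simp only [zero_add, show (1 : Fin 4) + 2 = 3 from rfl] at k0 k1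
    have f0 := hf c 0
    have f2 := hf c 2
    have f0' := hf' c 0
    have hk0 : endValue o k c 0 = 1 ∨ endValue o k c 0 = -1 := by
      rcases endValue_zero_two (o := o) k c with ⟨h₁, h₂⟩ | ⟨h₁, h₂⟩
      · left; rw [h₁, hk₁]
      · right; rw [k0, hk₁] at h₂; omega
    have hkout : k (arcOut o c) = 1 := by
      rcases endValue_zero_two (o := o) k c with ⟨h₁, h₂⟩ | ⟨h₁, h₂⟩ <;> rw [h₁, h₂, hk₁] at k0 <;>
        omega
    have hk1 : endValue o k c 1 = endValue o k c 0 ∨ endValue o k c 1 = -endValue o k c 0 := by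
      have hD : endValue o f c 0 = 1 ∧ endValue o f c 2 = 1 := by
        rcases endValue_zero_two (o := o) f c with ⟨h₁, h₂⟩ | ⟨h₁, h₂⟩ <;>
          rw [h₁, h₂, hf₁, h1] <;> exact ⟨by norm_num, by norm_num⟩
      have h13 : endValue o f c 1 = -1 ∧ endValue o f c 3 = -1 := by
        cases hb : σ c <;> simp only [hb, partner] at f0 f2 <;> simp at f0 f2 <;>
          simp [f0, f2, hD]
      rw [Fin.sum_univ_four] at hpair
      simp only [hsqk, k0, k1, hD, h13] at hpair
      have : endValue o k c 1 * endValue o k c 1 = endValue o k c 0 * endValue o k c 0 := by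
        linarith
      exact mul_self_eq_mul_self_iff.1 this
    -- Hence k agrees up to sign on the two strands, and the sign decides for which of the two
    -- smoothings k is signed. There f · k is unsigned but takes the values 1 and -1 on one circle.
    have hcon : IsSigned o σ k ∨ IsSigned o σ' k := by
      have off : ∀ x, x ≠ c → ∀ p, endValue o k x (partner (σ x) p) = -endValue o k x p :=
        fun x hx p => by simpa [hx] using hk x p
      have hA : ∀ b : Bool, (endValue o k c 1 = endValue o k c 0 ∧ b = true) ∨
          (endValue o k c 1 = -endValue o k c 0 ∧ b = false) →
          ∀ p, endValue o k c (partner b p) = -endValue o k c p := by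
        rintro b (⟨h1, rfl⟩ | ⟨h1, rfl⟩) p <;> fin_cases p <;> simp [partner, k0, k1, h1]
      have hne := h.1
      have : (endValue o k c 1 = endValue o k c 0 ∧ (σ c = true ∨ σ' c = true)) ∨
          (endValue o k c 1 = -endValue o k c 0 ∧ (σ c = false ∨ σ' c = false)) := by
        rcases hk1 with e | e
        · left; refine ⟨e, ?_⟩; cases h : σ c <;> cases h' : σ' c <;> simp_all
        · right; refine ⟨e, ?_⟩; cases h : σ c <;> cases h' : σ' c <;> simp_all
      have h₁ : ∀ p, (σ c = true ∧ endValue o k c 1 = endValue o k c 0) ∨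
          (σ c = false ∧ endValue o k c 1 = -endValue o k c 0) →
          endValue o k c (partner (σ c) p) = -endValue o k c p := fun p hh =>
        hA _ (by tauto) p
      have h₂ : ∀ p, (σ' c = true ∧ endValue o k c 1 = endValue o k c 0) ∨
          (σ' c = false ∧ endValue o k c 1 = -endValue o k c 0) →
          endValue o k c (partner (σ' c) p) = -endValue o k c p := fun p hh =>
        hA _ (by tauto) p
      by_cases hh : (σ c = true ∧ endValue o k c 1 = endValue o k c 0) ∨
          (σ c = false ∧ endValue o k c 1 = -endValue o k c 0)
      · left
        intro x p
        by_cases hx : x = c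
        · subst hx; exact h₁ p hh
        · exact off x hx p
      · right
        intro x p
        by_cases hx : x = c
        · subst hx; exact h₂ p (by tauto)
        · rw [← h.2 x hx]; exact off x hx p
    rcases hcon with hcon | hcon
    · have := (isUnsigned_signed_mul_signed hf hcon).eq hs
      simp only [hf₁, hk₁, h1, hkout] at this
      omega
    · have := (isUnsigned_signed_mul_signed hf' hcon).eq hs'
      simp only [hf₁, hk₁, h1, hkout] at this
      omega

theorem sameCircle_end (o : D.Orientation) (σ : Fin D.n → Bool) (c : Fin D.n) (p : Fin 4) :
    D.SameCircle σ (D.arc c p) (arcIn o c) ∨ D.SameCircle σ (D.arc c p) (arcOut o c) := by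
  have key : ∀ q : Fin 4, q = 0 ∨ q = 2 → D.arc c q = arcIn o c ∨ D.arc c q = arcOut o c := by
    rintro q (rfl | rfl) <;> simp only [arcIn, arcOut, underIn, underOut] <;>
      cases o.inward c 0 <;> simp
  by_cases hp : p = 0 ∨ p = 2
  · rcases key p hp with h | h <;> rw [h]
    · exact Or.inl (SameCircle.refl _ _)
    · exact Or.inr (SameCircle.refl _ _)
  · have hq : partner (σ c) p = 0 ∨ partner (σ c) p = 2 := by
      cases σ c <;> fin_cases p <;> simp_all [partner]
    have := sameCircle_partner σ c p
    rcases key _ hq with h | h <;> rw [h] at this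
    · exact Or.inl this
    · exact Or.inr this

/-- When the two under-ends share a circle of σ', all four ends at `c` do, so changing the smoothing
at `c` back and forth cannot separate arcs in σ' that were joined in σ. -/
theorem SameCircle.mono {c : Fin D.n} {σ σ' : Fin D.n → Bool} (h : Adjacent c σ σ')
    (hs : D.SameCircle σ' (arcIn o c) (arcOut o c)) {a b : Fin D.N}
    (hab : D.SameCircle σ a b) : D.SameCircle σ' a b := by
  rw [← circleOf_eq_iff]
  refine hab.apply_eq (g := D.circleOf σ') fun x p => ?_
  by_cases hx : x = c
  · subst hx
    have key : ∀ q, D.SameCircle σ' (D.arc x q) (arcIn o x) := fun q =>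
      (sameCircle_end o σ' x q).elim id fun h => h.trans hs.symm
    exact circleOf_eq_iff.2 ((key _).trans (key _).symm)
  · rw [h.2 x hx]
    exact circleOf_partner σ' x p

theorem sameCircle_iff_of_sameCircle {c : Fin D.n} {σ σ' : Fin D.n → Bool} (h : Adjacent c σ σ')
    (hs : D.SameCircle σ (arcIn o c) (arcOut o c))
    (hs' : D.SameCircle σ' (arcIn o c) (arcOut o c)) {a b : Fin D.N} :
    D.SameCircle σ a b ↔ D.SameCircle σ' a b :=
  ⟨SameCircle.mono h hs', SameCircle.mono h.symm hs⟩

/-- Circles after a merge. -/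
theorem sameCircle_merge_iff {c : Fin D.n} {σ σ' : Fin D.n → Bool} (h : Adjacent c σ σ')
    (hn : ¬ D.SameCircle σ (arcIn o c) (arcOut o c)) {a b : Fin D.N} :
    D.SameCircle σ' a b ↔ D.SameCircle σ a b ∨
      ((D.SameCircle σ a (arcIn o c) ∨ D.SameCircle σ a (arcOut o c)) ∧
        (D.SameCircle σ b (arcIn o c) ∨ D.SameCircle σ b (arcOut o c))) := by
  have hs := sameCircle_of_not_sameCircle h hn
  constructor
  · intro hab
    -- This names the circles of σ after gluing the outgoing circle to the incoming one; it is
    -- constant on the circles of σ'.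
    let g : Fin D.N → Fin D.N := fun a =>
      if D.SameCircle σ a (arcOut o c) then D.circleOf σ (arcIn o c) else D.circleOf σ a
    have hg : g a = g b := by
      refine hab.apply_eq fun x p => ?_
      by_cases hx : x = c
      · subst hx
        have key : ∀ q, g (D.arc x q) = D.circleOf σ (arcIn o x) := by
          intro q
          simp only [g]
          split_ifs with h1
          · rfl
          · exact circleOf_eq_iff.2 ((sameCircle_end o σ x q).resolve_right h1)
        rw [key, key]
      · rw [← h.2 x hx]
        have h1 := sameCircle_partner σ x p
        have : D.SameCircle σ (D.arc x p) (arcOut o c) ↔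
            D.SameCircle σ (D.arc x (partner (σ x) p)) (arcOut o c) :=
          ⟨fun h => h1.symm.trans h, fun h => h1.trans h⟩
        simp only [g, this, circleOf_partner σ x p]
    simp only [g] at hg
    split_ifs at hg with h1 h2 h2
    · exact Or.inr ⟨Or.inr h1, Or.inr h2⟩
    · exact Or.inr ⟨Or.inr h1, Or.inl (circleOf_eq_iff.1 hg).symm⟩
    · exact Or.inr ⟨Or.inl (circleOf_eq_iff.1 hg), Or.inr h2⟩
    · exact Or.inl (circleOf_eq_iff.1 hg)
  · rintro (hab | ⟨ha, hb⟩)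
    · exact SameCircle.mono h hs hab
    · have key : ∀ x, D.SameCircle σ x (arcIn o c) ∨ D.SameCircle σ x (arcOut o c) →
          D.SameCircle σ' x (arcIn o c) := by
        rintro x (hx | hx)
        · exact SameCircle.mono h hs hx
        · exact (SameCircle.mono h hs hx).trans hs.symm
      exact (key a ha).trans (key b hb).symm

theorem circleOf_merge {c : Fin D.n} {σ σ' : Fin D.n → Bool} (h : Adjacent c σ σ')
    (hn : ¬ D.SameCircle σ (arcIn o c) (arcOut o c)) {a : Fin D.N}
    (h₁ : ¬ D.SameCircle σ a (arcIn o c)) (h₂ : ¬ D.SameCircle σ a (arcOut o c)) :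
    D.circleOf σ' a = D.circleOf σ a := by
  have : ∀ b, D.SameCircle σ' a b ↔ D.SameCircle σ a b := fun b => by
    rw [sameCircle_merge_iff h hn]
    tauto
  exact le_antisymm (circleOf_le ((this _).2 (sameCircle_circleOf σ a)))
    (circleOf_le ((this _).1 (sameCircle_circleOf σ' a)))

/-- The circles that do not pass through the crossing `c`. -/
def otherCircles (o : D.Orientation) (σ : Fin D.n → Bool) (c : Fin D.n) : Finset (Fin D.N) :=
  ((D.circles σ).erase (D.circleOf σ (arcIn o c))).erase (D.circleOf σ (arcOut o c))

theorem mem_otherCircles {σ : Fin D.n → Bool} {c : Fin D.n} {a : Fin D.N} :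
    a ∈ otherCircles o σ c ↔ D.circleOf σ a = a ∧ ¬ D.SameCircle σ a (arcIn o c) ∧
      ¬ D.SameCircle σ a (arcOut o c) := by
  simp only [otherCircles, Finset.mem_erase, mem_circles_iff, ← circleOf_eq_iff]
  constructor
  · rintro ⟨h₁, h₂, h₃⟩
    rw [h₃]
    exact ⟨rfl, h₂, h₁⟩
  · rintro ⟨h₃, h₂, h₁⟩
    rw [h₃] at h₁ h₂
    exact ⟨h₁, h₂, h₃⟩

theorem otherCircles_merge {c : Fin D.n} {σ σ' : Fin D.n → Bool} (h : Adjacent c σ σ')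
    (hn : ¬ D.SameCircle σ (arcIn o c) (arcOut o c)) :
    otherCircles o σ' c = otherCircles o σ c := by
  have hs := sameCircle_of_not_sameCircle h hn
  ext a
  rw [mem_otherCircles, mem_otherCircles]
  have h₁ : (¬ D.SameCircle σ' a (arcIn o c) ∧ ¬ D.SameCircle σ' a (arcOut o c)) ↔
      (¬ D.SameCircle σ a (arcIn o c) ∧ ¬ D.SameCircle σ a (arcOut o c)) := by
    rw [sameCircle_merge_iff h hn, sameCircle_merge_iff h hn]
    have := SameCircle.refl σ (arcIn o c)
    have := SameCircle.refl σ (arcOut o c)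
    tauto
  rw [h₁]
  constructor <;> rintro ⟨h₂, h₃, h₄⟩ <;> refine ⟨?_, h₃, h₄⟩
  · rwa [circleOf_merge h hn h₃ h₄] at h₂
  · rwa [circleOf_merge h hn h₃ h₄]

theorem circles_eq_cons {σ : Fin D.n → Bool} {c : Fin D.n}
    (hs : D.SameCircle σ (arcIn o c) (arcOut o c)) :
    D.circles σ = insert (D.circleOf σ (arcIn o c)) (otherCircles o σ c) ∧
      D.circleOf σ (arcIn o c) ∉ otherCircles o σ c := by
  have h := circleOf_mem_circles σ (arcIn o c)
  have e := circleOf_eq_iff.2 hs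
  unfold otherCircles
  rw [← e, Finset.erase_idem]
  exact ⟨(Finset.insert_erase h).symm, Finset.notMem_erase _ _⟩

theorem circles_eq_cons_cons {σ : Fin D.n → Bool} {c : Fin D.n}
    (hn : ¬ D.SameCircle σ (arcIn o c) (arcOut o c)) :
    D.circles σ = insert (D.circleOf σ (arcIn o c)) (insert (D.circleOf σ (arcOut o c))
      (otherCircles o σ c)) ∧ D.circleOf σ (arcIn o c) ∉ insert (D.circleOf σ (arcOut o c))
      (otherCircles o σ c) ∧ D.circleOf σ (arcOut o c) ∉ otherCircles o σ c := by
  have h := circleOf_mem_circles σ (arcIn o c)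
  have h' := circleOf_mem_circles σ (arcOut o c)
  have e : D.circleOf σ (arcIn o c) ≠ D.circleOf σ (arcOut o c) :=
    fun e => hn (circleOf_eq_iff.1 e)
  unfold otherCircles
  rw [Finset.insert_erase (Finset.mem_erase.2 ⟨e.symm, h'⟩), Finset.insert_erase h]
  exact ⟨rfl, Finset.notMem_erase _ _, Finset.notMem_erase _ _⟩

theorem card_circles_merge {c : Fin D.n} {σ σ' : Fin D.n → Bool} (h : Adjacent c σ σ')
    (hn : ¬ D.SameCircle σ (arcIn o c) (arcOut o c)) :
    (D.circles σ).card = (D.circles σ').card + 1 := by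
  obtain ⟨h₁, h₂, h₃⟩ := circles_eq_cons_cons hn
  obtain ⟨h₄, h₅⟩ := circles_eq_cons (sameCircle_of_not_sameCircle h hn)
  rw [h₁, h₄, Finset.card_insert_of_notMem h₂, Finset.card_insert_of_notMem h₃,
    Finset.card_insert_of_notMem h₅, otherCircles_merge h hn]

theorem circles_eq_of_sameCircle {c : Fin D.n} {σ σ' : Fin D.n → Bool} (h : Adjacent c σ σ')
    (hs : D.SameCircle σ (arcIn o c) (arcOut o c))
    (hs' : D.SameCircle σ' (arcIn o c) (arcOut o c)) : D.circles σ = D.circles σ' := by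
  simp only [circles, sameCircle_iff_of_sameCircle h hs hs']

end Surgery

/-! ### Exterior products over finite sets of indices -/

section Exterior

open ExteriorAlgebra CliffordAlgebra

variable {I M : Type*} [LinearOrder I] [AddCommGroup M]

/-- The exterior product of the vectors `v a`, `a ∈ S`, in increasing order. -/
def wedge (v : I → M) (S : Finset I) : ExteriorAlgebra ℤ M :=
  ((S.sort (· ≤ ·)).map fun a => ExteriorAlgebra.ι ℤ (v a)).prod

@[simp]
theorem wedge_empty (v : I → M) : wedge v ∅ = 1 := by simp [wedge]

theorem wedge_insert_min (v : I → M) {a : I} {S : Finset I} (h : ∀ b ∈ S, a < b) :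
    wedge v (insert a S) = ExteriorAlgebra.ι ℤ (v a) * wedge v S := by
  unfold wedge
  rw [Finset.sort_insert (r := (· ≤ ·)) (fun b hb => (h b hb).le) (fun ha => (h a ha).ne rfl),
    List.map_cons, List.prod_cons]

theorem wedge_congr {v v' : I → M} {S : Finset I} (h : ∀ a ∈ S, v a = v' a) :
    wedge v S = wedge v' S := by
  unfold wedge
  congr 1
  refine List.map_congr_left fun a ha => ?_
  rw [h a (by simpa using ha)]

/-- Each transposition past a smaller index costs a sign; this matches the exponent in `headSign`.
-/
theorem wedge_eq_head (v : I → M) {S : Finset I} {f : I} (hf : f ∈ S) :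
    wedge v S = ((-1 : ℤ) ^ (S.filter fun a => a < f).card) •
      (ExteriorAlgebra.ι ℤ (v f) * wedge v (S.erase f)) := by
  induction S using Finset.induction_on_min with
  | empty => simp at hf
  | insert a S h ih =>
    have ha : a ∉ S := fun ha => (h a ha).ne rfl
    rw [wedge_insert_min v h]
    rcases Finset.mem_insert.1 hf with rfl | hf'
    · rw [Finset.erase_insert ha]
      have : (insert f S).filter (fun a => a < f) = ∅ := by
        refine Finset.filter_eq_empty_iff.2 fun b hb => ?_
        rcases Finset.mem_insert.1 hb with rfl | hb
        · exact lt_irrefl b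
        · exact (h b hb).not_gt
      simp [this]
    · have hne : a ≠ f := fun e => ha (e ▸ hf')
      rw [Finset.erase_insert_of_ne hne,
        wedge_insert_min v (fun b hb => h b (Finset.mem_of_mem_erase hb)),
        Finset.filter_insert, if_pos (h f hf'), Finset.card_insert_of_notMem
          (fun h' => ha (Finset.mem_filter.1 h').1), ih hf', pow_succ, mul_smul_comm,
        ← mul_assoc, ← mul_assoc, mul_neg_one, neg_smul, ← smul_neg, ← neg_mul]
      congr 2
      exact eq_neg_of_add_eq_zero_left (ExteriorAlgebra.ι_add_mul_swap _ _)

theorem contractLeft_wedge_congr {v : I → M} {S : Finset I} {y y' : Module.Dual ℤ M}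
    (h : ∀ a ∈ S, y (v a) = y' (v a)) :
    contractLeft (Q := (0 : QuadraticForm ℤ M)) y (wedge v S) = contractLeft y' (wedge v S) := by
  induction S using Finset.induction_on_min with
  | empty => simp [wedge_empty]
  | insert a S ha ih =>
    rw [wedge_insert_min v ha]
    erw [contractLeft_ι_mul, contractLeft_ι_mul]
    rw [h a (Finset.mem_insert_self a S), ih fun b hb => h b (Finset.mem_insert_of_mem hb)]

theorem contractLeft_wedge_eq_zero {v : I → M} {S : Finset I} {y : Module.Dual ℤ M}
    (h : ∀ a ∈ S, y (v a) = 0) :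
    contractLeft (Q := (0 : QuadraticForm ℤ M)) y (wedge v S) = 0 := by
  rw [contractLeft_wedge_congr (y' := 0) (by simpa using h)]
  simp

/-- Contracting successively with the dual functionals strips off one vector at a time. This makes
the wedge torsion-free, so that signs can be read off from its multiples. -/
theorem exists_map_wedge_eq_one {v : I → M} (y : I → Module.Dual ℤ M) (S : Finset I)
    (h : ∀ a ∈ S, ∀ b ∈ S, y a (v b) = if a = b then 1 else 0) :
    ∃ L : ExteriorAlgebra ℤ M →ₗ[ℤ] ExteriorAlgebra ℤ M, L (wedge v S) = 1 := by
  induction S using Finset.induction_on_min with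
  | empty => exact ⟨LinearMap.id, by simp⟩
  | insert a S ha ih =>
    obtain ⟨L, hL⟩ := ih fun x hx z hz =>
      h x (Finset.mem_insert_of_mem hx) z (Finset.mem_insert_of_mem hz)
    refine ⟨L ∘ₗ contractLeft (Q := (0 : QuadraticForm ℤ M)) (y a), ?_⟩
    have e : contractLeft (Q := (0 : QuadraticForm ℤ M)) (y a) (wedge v (insert a S)) =
        wedge v S := by
      rw [wedge_insert_min v ha]
      erw [contractLeft_ι_mul]
      rw [h a (Finset.mem_insert_self a S) a (Finset.mem_insert_self a S),
        contractLeft_wedge_eq_zero fun b hb => by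
          rw [h a (Finset.mem_insert_self a S) b (Finset.mem_insert_of_mem hb),
            if_neg (ha b hb).ne]]
      simp
    rw [LinearMap.comp_apply, e, hL]

theorem smul_wedge_injective {v : I → M} (y : I → Module.Dual ℤ M) (S : Finset I)
    (h : ∀ a ∈ S, ∀ b ∈ S, y a (v b) = if a = b then 1 else 0) {m n : ℤ}
    (hmn : m • wedge v S = n • wedge v S) : m = n := by
  obtain ⟨L, hL⟩ := exists_map_wedge_eq_one y S h
  have := congrArg L hmn
  rw [map_smul, map_smul, hL, ← Algebra.algebraMap_eq_smul_one, ← Algebra.algebraMap_eq_smul_one]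
    at this
  exact (ExteriorAlgebra.algebraMap_inj M m n).1 this

end Exterior

/-! ### Signs of merges -/

section MergeSigns

open CliffordAlgebra

variable {D : VirtualDiagram} (o : D.Orientation)

/-- The exterior product of the indicator functions of the circles. -/
def circleForm (σ : Fin D.n → Bool) : ExteriorAlgebra ℤ (Fin D.N → ℤ) :=
  wedge (circleIndicator ℤ σ) (D.circles σ)

/-- The difference of the values at the two under-ends of the crossing `c`. -/
def endDifference (c : Fin D.n) : Module.Dual ℤ (Fin D.N → ℤ) :=
  LinearMap.proj (R := ℤ) (φ := fun _ => ℤ) (arcIn o c) - LinearMap.proj (arcOut o c)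

/-- Contraction with the difference of the values at the under-ends of the crossing `c`. -/
def contractEnds (c : Fin D.n) :
    ExteriorAlgebra ℤ (Fin D.N → ℤ) →ₗ[ℤ] ExteriorAlgebra ℤ (Fin D.N → ℤ) :=
  contractLeft (Q := (0 : QuadraticForm ℤ (Fin D.N → ℤ))) (endDifference o c)

/-- The sign of the merge at the crossing `c` from the state `σ` to the state `σ'`, and of the split
in the opposite direction. -/
def mergeSign (c : Fin D.n) (σ σ' : Fin D.n → Bool) : ℤ :=
  headSign₂ σ (D.circleOf σ (arcIn o c)) (D.circleOf σ (arcOut o c)) *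
    headSign σ' (D.circleOf σ' (arcIn o c))

theorem headSign_mul_self (σ : Fin D.n → Bool) (f : Fin D.N) :
    headSign σ f * headSign σ f = 1 := by
  rw [headSign, ← mul_pow]; simp

theorem headSign₂_mul_self (σ : Fin D.n → Bool) (f g : Fin D.N) :
    headSign₂ σ f g * headSign₂ σ f g = 1 := by
  rw [headSign₂, ← mul_pow]; simp

theorem mergeSign_mul_self (c : Fin D.n) (σ σ' : Fin D.n → Bool) :
    mergeSign o c σ σ' * mergeSign o c σ σ' = 1 := by
  rw [mergeSign, mul_mul_mul_comm, headSign₂_mul_self, headSign_mul_self, one_mul]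

theorem contractEnds_comm (c d : Fin D.n) (x : ExteriorAlgebra ℤ (Fin D.N → ℤ)) :
    contractEnds o c (contractEnds o d x) = -contractEnds o d (contractEnds o c x) :=
  contractLeft_comm _ _ _

variable {o}

theorem smul_circleForm_injective {σ : Fin D.n → Bool} {m n : ℤ}
    (h : m • circleForm σ = n • circleForm σ) : m = n := by
  refine smul_wedge_injective (fun a => LinearMap.proj a) (D.circles σ) (fun a ha b hb => ?_) h
  rw [mem_circles_iff] at ha hb
  simp only [LinearMap.proj_apply, circleIndicator, ← circleOf_eq_iff, ha, hb, eq_comm]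

theorem circleIndicator_apply_circleOf (σ : Fin D.n → Bool) (a b : Fin D.N) :
    circleIndicator ℤ σ (D.circleOf σ a) b = if D.SameCircle σ a b then 1 else 0 := by
  unfold circleIndicator
  congr 1
  exact propext ⟨fun h => (sameCircle_circleOf σ a).trans h,
    fun h => (sameCircle_circleOf σ a).symm.trans h⟩

/-- Write the wedge as u ∧ v ∧ W with u, v the indicators of the merging circles. The functional is
1 on u, -1 on v and 0 on the factors of W, so the contraction is (u + v) ∧ W, and u + v is the
indicator of the merged circle. The reorderings before and after account for `mergeSign`. -/
theorem contractEnds_circleForm {c : Fin D.n} {σ σ' : Fin D.n → Bool} (h : Adjacent c σ σ')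
    (hn : ¬ D.SameCircle σ (arcIn o c) (arcOut o c)) :
    contractEnds o c (circleForm σ) = mergeSign o c σ σ' • circleForm σ' := by
  have hs := sameCircle_of_not_sameCircle h hn
  set v := circleIndicator ℤ σ with hv
  set v' := circleIndicator ℤ σ' with hv'
  set f := D.circleOf σ (arcIn o c) with hf
  set g := D.circleOf σ (arcOut o c) with hg
  set f' := D.circleOf σ' (arcIn o c) with hf'
  have hfg : f ≠ g := fun e => hn (circleOf_eq_iff.1 e)
  set W := wedge v (otherCircles o σ c) with hW
  have e₁ : circleForm σ = headSign₂ σ f g •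
      (ExteriorAlgebra.ι ℤ (v f) * (ExteriorAlgebra.ι ℤ (v g) * W)) := by
    rw [circleForm, wedge_eq_head _ (circleOf_mem_circles σ (arcIn o c)),
      wedge_eq_head _ (Finset.mem_erase.2 ⟨hfg.symm, circleOf_mem_circles σ (arcOut o c)⟩),
      mul_smul_comm, smul_smul, ← pow_add, headSign₂]
    congr 4
    ext a
    simp only [Finset.mem_filter, Finset.mem_erase]
    tauto
  have e₂ : circleForm σ' = headSign σ' f' • (ExteriorAlgebra.ι ℤ (v' f') * W) := by
    rw [circleForm, wedge_eq_head _ (circleOf_mem_circles σ' (arcIn o c)), headSign]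
    obtain ⟨h₁, h₂⟩ := circles_eq_cons hs
    have : (D.circles σ').erase f' = otherCircles o σ c := by
      rw [h₁, Finset.erase_insert h₂, otherCircles_merge h hn]
    rw [this]
    congr 2
    refine wedge_congr fun a ha => ?_
    obtain ⟨-, h₃, h₄⟩ := mem_otherCircles.1 ha
    ext b
    simp only [circleIndicator, sameCircle_merge_iff h hn]
    congr 1
    apply propext
    tauto
  have hv'f : v' f' = v f + v g := by
    ext b
    rw [Pi.add_apply, hv, hv', hf, hf', hg, circleIndicator_apply_circleOf,
      circleIndicator_apply_circleOf, circleIndicator_apply_circleOf]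
    have r := SameCircle.refl σ (arcIn o c)
    have key : D.SameCircle σ' (arcIn o c) b ↔
        D.SameCircle σ (arcIn o c) b ∨ D.SameCircle σ (arcOut o c) b := by
      rw [sameCircle_merge_iff h hn]
      have h₁ : D.SameCircle σ b (arcIn o c) ↔ D.SameCircle σ (arcIn o c) b :=
        ⟨fun h => h.symm, fun h => h.symm⟩
      have h₂ : D.SameCircle σ b (arcOut o c) ↔ D.SameCircle σ (arcOut o c) b :=
        ⟨fun h => h.symm, fun h => h.symm⟩
      rw [h₁, h₂]
      tauto
    rw [if_congr key rfl rfl]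
    by_cases h₁ : D.SameCircle σ (arcIn o c) b <;> by_cases h₂ : D.SameCircle σ (arcOut o c) b
    · exact absurd (h₁.trans h₂.symm) hn
    all_goals simp [h₁, h₂]
  have hn' : ¬ D.SameCircle σ (arcOut o c) (arcIn o c) := fun e => hn e.symm
  have yf : endDifference o c (v f) = 1 := by
    simp [endDifference, hv, hf, circleIndicator_apply_circleOf, SameCircle.refl, hn]
  have yg : endDifference o c (v g) = -1 := by
    simp [endDifference, hv, hg, circleIndicator_apply_circleOf, SameCircle.refl, hn']
  have yW : contractEnds o c W = 0 := by
    refine contractLeft_wedge_eq_zero fun a ha => ?_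
    obtain ⟨-, h₃, h₄⟩ := mem_otherCircles.1 ha
    simp [endDifference, hv, circleIndicator, h₃, h₄]
  have step : contractEnds o c (ExteriorAlgebra.ι ℤ (v f) * (ExteriorAlgebra.ι ℤ (v g) * W)) =
      ExteriorAlgebra.ι ℤ (v' f') * W := by
    have h₁ : ∀ (m : Fin D.N → ℤ) (x : ExteriorAlgebra ℤ (Fin D.N → ℤ)),
        contractEnds o c (ExteriorAlgebra.ι ℤ m * x) =
          endDifference o c m • x - ExteriorAlgebra.ι ℤ m * contractEnds o c x :=
      fun m x => contractLeft_ι_mul (endDifference o c) m x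
    rw [h₁, h₁, yW, yf, yg, hv'f, map_add, add_mul]
    simp [add_comm]
  rw [e₁, map_smul, step, e₂, smul_smul, mergeSign, mul_assoc, headSign_mul_self, mul_one]

/-- A contraction of the wedge sees only the values of the functional on the indicators of circles.
-/
theorem contractEnds_circleForm_congr {c d : Fin D.n} {σ : Fin D.n → Bool} {δ : ℤ}
    (h : ∀ g : Fin D.N → ℤ, IsUnsigned σ g →
      g (arcIn o c) - g (arcOut o c) = δ * (g (arcIn o d) - g (arcOut o d))) :
    contractEnds o c (circleForm σ) = δ • contractEnds o d (circleForm σ) := by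
  have : contractLeft (Q := (0 : QuadraticForm ℤ (Fin D.N → ℤ))) (endDifference o c)
      (circleForm σ) = contractLeft (δ • endDifference o d) (circleForm σ) := by
    refine contractLeft_wedge_congr fun a _ => ?_
    have := h _ (isUnsigned_circleIndicator ℤ σ a)
    simpa [endDifference] using this
  rw [contractEnds, this, map_smul]
  rfl

end MergeSigns

/-! ### Transport along circles -/

section Transport

variable {D : VirtualDiagram} {o : D.Orientation} {B : Type*} [CommRing B]

/-- The sign of a number of cut points modulo 2. -/
def paritySign (z : ZMod 2) : ℤ := if z = 0 then 1 else -1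

theorem paritySign_add (z w : ZMod 2) : paritySign (z + w) = paritySign z * paritySign w := by
  revert z w; decide

theorem paritySign_mul_self (z : ZMod 2) : paritySign z * paritySign z = 1 := by
  revert z; decide

theorem endValue_eq_paritySign_mul (f : Fin D.N → B) (c : Fin D.n) (p : Fin 4) :
    endValue o f c p =
      (if p = 0 ∨ p = 2 then 1 else -1) * ((paritySign (cutParity o c p) : ℤ) : B) *
        f (D.arc c p) := by
  unfold endValue cutParity IsCut paritySign
  by_cases hp : p = 0 ∨ p = 2 <;> cases o.inward c p <;> simp [hp]

theorem under_partner_iff (b : Bool) (p : Fin 4) :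
    (partner b p = 0 ∨ partner b p = 2) ↔ ¬ (p = 0 ∨ p = 2) := by
  cases b <;> fin_cases p <;> simp [partner]

/-- The orientation signs of `o` differ from the source–sink signs (plus at under-ends, minus at
over-ends) exactly at the cut points, and a smoothing always joins an under-end to an over-end.
Hence f, corrected by the parity of cut points passed, is constant along the path. -/
theorem IsSigned.eq_of_cutPath {σ : Fin D.n → Bool} {f : Fin D.N → B} (hf : IsSigned o σ f)
    {x y : Fin D.N × ZMod 2} (h : CutPath o σ x y) :
    f x.1 * (paritySign x.2 : ℤ) = f y.1 * (paritySign y.2 : ℤ) := by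
  induction h with
  | rel x y h =>
    obtain ⟨c, p, h₁, h₂, h₃⟩ := h
    have h := hf c p
    rw [endValue_eq_paritySign_mul, endValue_eq_paritySign_mul, if_congr (under_partner_iff _ _) rfl rfl] at h
    rw [h₁, h₂, h₃, paritySign_add, paritySign_add]
    have e : ((paritySign (cutParity o c p) : ℤ) : B) * (paritySign (cutParity o c p) : ℤ) = 1 :=
      by exact_mod_cast congrArg (Int.cast : ℤ → B) (paritySign_mul_self _)
    push_cast
    split_ifs at h
    · simp only [neg_mul, one_mul] at h
      have h := neg_injective h
      linear_combination -f (D.arc c p) * (paritySign x.2 : B) * e -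
        (paritySign x.2 : B) * ((paritySign (cutParity o c p) : ℤ) : B) * h
    · simp only [neg_mul, one_mul, neg_neg] at h
      linear_combination -f (D.arc c p) * (paritySign x.2 : B) * e -
        (paritySign x.2 : B) * ((paritySign (cutParity o c p) : ℤ) : B) * h
  | refl x => rfl
  | symm x y _ ih => exact ih.symm
  | trans x y z _ _ ih₁ ih₂ => exact ih₁.trans ih₂

variable (o) in
theorem SameCircle.exists_cutPath {σ : Fin D.n → Bool} {a b : Fin D.N}
    (h : D.SameCircle σ a b) : ∃ e, ∀ t, CutPath o σ (a, t) (b, t + e) := by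
  induction h with
  | rel x y h =>
    obtain ⟨c, p, h₁, h₂⟩ := h
    exact ⟨cutParity o c p + cutParity o c (partner (σ c) p), fun t =>
      Relation.EqvGen.rel _ _ ⟨c, p, h₁, h₂, (add_assoc _ _ _).symm⟩⟩
  | refl x => exact ⟨0, fun t => by rw [add_zero]; exact Relation.EqvGen.refl _⟩
  | symm x y _ ih =>
    obtain ⟨e, he⟩ := ih
    refine ⟨-e, fun t => Relation.EqvGen.symm _ _ ?_⟩
    have := he (t + -e)
    rwa [neg_add_cancel_right] at this
  | trans x y z _ _ ih₁ ih₂ =>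
    obtain ⟨e, he⟩ := ih₁
    obtain ⟨e', he'⟩ := ih₂
    exact ⟨e + e', fun t => Relation.EqvGen.trans _ _ _ (he t)
      (by rw [← add_assoc]; exact he' (t + e))⟩

/-- Any path between base point and site has the same effect on f; the two possible parities of the
path are the two cases of `transport`. -/
theorem IsSigned.apply_circleOf {σ : Fin D.n → Bool} {f : Fin D.N → B} (hf : IsSigned o σ f)
    (c : Fin D.n) (p : Fin 4) : f (D.circleOf σ (D.arc c p)) =
      (transport o σ c p : ℤ) * ((paritySign (cutParity o c p) : ℤ) * f (D.arc c p)) := by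
  unfold transport
  split_ifs with h
  · have := hf.eq_of_cutPath h
    have e : paritySign 0 = 1 := rfl
    simp only [e, Int.cast_one, mul_one] at this
    rw [this]; push_cast; ring
  · obtain ⟨e, he⟩ := (sameCircle_circleOf σ (D.arc c p)).symm.exists_cutPath o
    have h0 := he 0
    rw [zero_add] at h0
    have hne : e ≠ cutParity o c p := fun h' => h (h' ▸ h0)
    have : e = cutParity o c p + 1 :=
      (by decide : ∀ x y : ZMod 2, x ≠ y → x = y + 1) _ _ hne
    have h1 := hf.eq_of_cutPath h0
    rw [this, paritySign_add] at h1
    have e0 : paritySign 0 = 1 := rfl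
    have e1 : paritySign 1 = -1 := rfl
    simp only [e0, e1, Int.cast_one, mul_one] at h1
    rw [h1]; push_cast; ring

theorem cutParity_underIn (c : Fin D.n) : cutParity o c (underIn o c) = 0 := by
  have h2 := o.straight c 0
  rw [zero_add] at h2
  unfold cutParity IsCut underIn
  cases h : o.inward c 0 <;> simp_all

theorem cutParity_underOut (c : Fin D.n) : cutParity o c (underOut o c) = 1 := by
  have h2 := o.straight c 0
  rw [zero_add] at h2
  unfold cutParity IsCut underOut
  cases h : o.inward c 0 <;> simp_all

theorem IsSigned.apply_circleOf_arcIn {σ : Fin D.n → Bool} {f : Fin D.N → B}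
    (hf : IsSigned o σ f) (c : Fin D.n) : f (D.circleOf σ (arcIn o c)) =
      (transport o σ c (underIn o c) : ℤ) * f (arcIn o c) := by
  have := hf.apply_circleOf c (underIn o c)
  rw [cutParity_underIn, show paritySign 0 = 1 from rfl] at this
  simpa [arcIn] using this

/-- The extra minus sign, absent at the incoming end, comes from the cut point on the outgoing
under-end. -/
theorem IsSigned.apply_circleOf_arcOut {σ : Fin D.n → Bool} {f : Fin D.N → B}
    (hf : IsSigned o σ f) (c : Fin D.n) : f (D.circleOf σ (arcOut o c)) =
      -((transport o σ c (underOut o c) : ℤ) * f (arcOut o c)) := by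
  have := hf.apply_circleOf c (underOut o c)
  rw [cutParity_underOut, show paritySign 1 = -1 from rfl] at this
  simpa [arcOut] using this

theorem transport_mul_self (σ : Fin D.n → Bool) (c : Fin D.n) (p : Fin 4) :
    transport o σ c p * transport o σ c p = 1 := by
  unfold transport; split_ifs <;> rfl

theorem IsSigned.const_mul {σ : Fin D.n → Bool} {f : Fin D.N → B} (hf : IsSigned o σ f) (b : B) :
    IsSigned o σ fun a => b * f a := by
  have h := isSigned_mul_isUnsigned hf (g := fun _ => b) (fun _ _ => rfl)
  simpa only [mul_comm] using h

end Transport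

/-! ### Evaluation of enhanced states -/

section Evaluation

variable {D : VirtualDiagram} {o : D.Orientation} {B : Type*} [CommRing B]

theorem EnhancedState.ext_of {s t : D.EnhancedState} (h₁ : s.state = t.state)
    (h₂ : ∀ a, s.label a = t.label a) : s = t := by
  cases s; cases t
  obtain rfl : _ = _ := h₁
  obtain rfl : _ = _ := funext h₂
  rfl

theorem EnhancedState.label_eq_of (s : D.EnhancedState) {a b : Fin D.N}
    (h : D.SameCircle s.state a b) : s.label a = s.label b :=
  h.apply_eq s.label_eq

theorem sameCircle_inOrOut_iff {c : Fin D.n} {σ τ : Fin D.n → Bool} (h : Adjacent c σ τ)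
    (a : Fin D.N) : (D.SameCircle σ a (arcIn o c) ∨ D.SameCircle σ a (arcOut o c)) ↔
      (D.SameCircle τ a (arcIn o c) ∨ D.SameCircle τ a (arcOut o c)) := by
  by_cases hs : D.SameCircle σ (arcIn o c) (arcOut o c)
  · by_cases ht : D.SameCircle τ (arcIn o c) (arcOut o c)
    · rw [sameCircle_iff_of_sameCircle h hs ht, sameCircle_iff_of_sameCircle h hs ht]
    · rw [sameCircle_merge_iff h.symm ht, sameCircle_merge_iff h.symm ht]
      have := SameCircle.refl τ (arcIn o c)
      have := SameCircle.refl τ (arcOut o c)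
      tauto
  · rw [sameCircle_merge_iff h hs, sameCircle_merge_iff h hs]
    have := SameCircle.refl σ (arcIn o c)
    have := SameCircle.refl σ (arcOut o c)
    tauto

/-- The enhanced state obtained from `s` by changing the smoothing at `c` and relabelling the
circles through the incoming and the outgoing under-end. -/
def relabel (s : D.EnhancedState) {c : Fin D.n} {τ : Fin D.n → Bool} (h : Adjacent c s.state τ)
    (o : D.Orientation) (v w : Bool) : D.EnhancedState where
  state := τ
  label a := if D.SameCircle τ a (arcIn o c) then v else
    if D.SameCircle τ a (arcOut o c) then w else s.label a
  label_eq := by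
    intro x p
    have h₀ := sameCircle_partner τ x p
    have h₁ : ∀ b, D.SameCircle τ (D.arc x p) b ↔ D.SameCircle τ (D.arc x (partner (τ x) p)) b :=
      fun b => ⟨fun h => h₀.symm.trans h, fun h => h₀.trans h⟩
    simp only [← h₁]
    by_cases hx : x = c
    · subst hx
      rcases sameCircle_end o τ x p with h' | h' <;> simp [h']
    · rw [← h.2 x hx, s.label_eq x p]

/-- The value of an enhanced state when the generator of a circle is the value of `F` at its base
point. -/
def evalState (F : Fin D.N → B) (s : D.EnhancedState) : B :=
  ∏ a ∈ D.circles s.state, if s.label a then F a else 1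

/-- The value of the circles of an enhanced state that do not pass through the crossing `c`. -/
def evalOthers (o : D.Orientation) (F : Fin D.N → B) (c : Fin D.n) (s : D.EnhancedState) : B :=
  ∏ a ∈ otherCircles o s.state c, if s.label a then F a else 1

theorem evalState_of_sameCircle {F : Fin D.N → B} {c : Fin D.n} {s : D.EnhancedState}
    (hs : D.SameCircle s.state (arcIn o c) (arcOut o c)) : evalState F s =
      (if s.label (arcIn o c) then F (D.circleOf s.state (arcIn o c)) else 1) *
        evalOthers o F c s := by
  obtain ⟨h₁, h₂⟩ := circles_eq_cons hs
  rw [evalState, h₁, Finset.prod_insert h₂,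
    ← s.label_eq_of (sameCircle_circleOf s.state (arcIn o c)), evalOthers]

theorem evalState_of_not_sameCircle {F : Fin D.N → B} {c : Fin D.n} {s : D.EnhancedState}
    (hs : ¬ D.SameCircle s.state (arcIn o c) (arcOut o c)) : evalState F s =
      (if s.label (arcIn o c) then F (D.circleOf s.state (arcIn o c)) else 1) *
      ((if s.label (arcOut o c) then F (D.circleOf s.state (arcOut o c)) else 1) *
        evalOthers o F c s) := by
  obtain ⟨h₁, h₂, h₃⟩ := circles_eq_cons_cons hs
  rw [evalState, h₁, Finset.prod_insert h₂, Finset.prod_insert h₃,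
    ← s.label_eq_of (sameCircle_circleOf s.state (arcIn o c)),
    ← s.label_eq_of (sameCircle_circleOf s.state (arcOut o c)), evalOthers]

theorem evalOthers_relabel {F : Fin D.N → B} {c : Fin D.n} {s : D.EnhancedState}
    {τ : Fin D.n → Bool} (h : Adjacent c s.state τ)
    (hn : ¬ D.SameCircle s.state (arcIn o c) (arcOut o c) ∨ ¬ D.SameCircle τ (arcIn o c) (arcOut o c))
    (v w : Bool) : evalOthers o F c (relabel s h o v w) = evalOthers o F c s := by
  have e : otherCircles o τ c = otherCircles o s.state c :=
    hn.elim (fun hn => otherCircles_merge h hn) (fun hn => (otherCircles_merge h.symm hn).symm)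
  unfold evalOthers
  rw [show (relabel s h o v w).state = τ from rfl, e]
  refine Finset.prod_congr rfl fun a ha => ?_
  rw [← e] at ha
  obtain ⟨-, h₁, h₂⟩ := mem_otherCircles.1 ha
  simp [relabel, h₁, h₂]

variable (o) in
/-- The sign of an edge of the cube of states; it vanishes for an edge along which one circle
becomes one circle. -/
def edgeSign (c : Fin D.n) (σ τ : Fin D.n → Bool) : ℤ :=
  if ¬ D.SameCircle σ (arcIn o c) (arcOut o c) then mergeSign o c σ τ else
    if ¬ D.SameCircle τ (arcIn o c) (arcOut o c) then mergeSign o c τ σ else 0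

variable (o) in
/-- The factor of an edge of the cube of states. -/
def edgeFactor (F : Fin D.N → B) (c : Fin D.n) (σ : Fin D.n → Bool) : B :=
  if D.SameCircle σ (arcIn o c) (arcOut o c) then F (arcIn o c) - F (arcOut o c) else 1

theorem relabel_of_partialCoeff_ne_zero {c : Fin D.n} {s t : D.EnhancedState}
    (h : Adjacent c s.state (Function.update s.state c true)) (hp : partialCoeff o c s t ≠ 0) :
    t = relabel s h o (t.label (arcIn o c)) (t.label (arcOut o c)) := by
  have h₁ : s.state c = false ∧ t.state = Function.update s.state c true ∧
      ∀ a, ¬ D.SameCircle s.state a (arcIn o c) → ¬ D.SameCircle s.state a (arcOut o c) →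
        t.label a = s.label a := by
    by_contra h₁
    rw [partialCoeff, if_neg h₁] at hp
    exact hp rfl
  obtain ⟨-, h₂, h₃⟩ := h₁
  refine EnhancedState.ext_of h₂ fun a => ?_
  simp only [relabel]
  split_ifs with h₄ h₅
  · exact t.label_eq_of (h₂ ▸ h₄)
  · exact t.label_eq_of (h₂ ▸ h₅)
  · have := (sameCircle_inOrOut_iff (o := o) h a).not.2 (by tauto)
    exact h₃ a (by tauto) (by tauto)

theorem relabel_label_off {c : Fin D.n} {s : D.EnhancedState} {τ : Fin D.n → Bool}
    (h : Adjacent c s.state τ) (v w : Bool) :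
    ∀ a, ¬ D.SameCircle s.state a (arcIn o c) → ¬ D.SameCircle s.state a (arcOut o c) →
      (relabel s h o v w).label a = s.label a := by
  intro a h₁ h₂
  have := (sameCircle_inOrOut_iff (o := o) h a).not.1 (by tauto)
  simp only [not_or] at this
  simp [relabel, this.1, this.2]

theorem adjacent_update {σ : Fin D.n → Bool} {c : Fin D.n} (h : σ c = false) :
    Adjacent c σ (Function.update σ c true) :=
  ⟨by simp [h], fun x hx => by simp [hx]⟩

/-- If the under-ends share a circle of σ, the factor F(in) - F(out) kills F(in) + F(out) because
squares of values vanish; otherwise that sum, multiplied by b, is already zero by the pairing. So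
the function passes from τ back to σ. -/
theorem isSigned_edge {F : Fin D.N → B} (hF : ∀ a, F a * F a = 0) {c : Fin D.n}
    {σ τ : Fin D.n → Bool} (h : Adjacent c σ τ) {b : B} (hb : IsSigned o τ fun a => b * F a) :
    IsSigned o σ fun a => b * edgeFactor o F c σ * F a := by
  have e : (fun a => b * edgeFactor o F c σ * F a) = fun a => edgeFactor o F c σ * (b * F a) := by
    ext a; ring
  rw [e]
  refine isSigned_adjacent h.symm (hb.const_mul _) ?_
  unfold edgeFactor
  split_ifs with hs
  · linear_combination b * hF (arcIn o c) - b * hF (arcOut o c)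
  · rw [one_mul, one_mul]
    exact add_eq_zero_of_not_sameCircle h hs hb

/-- Under evaluation an edge map becomes multiplication by a scalar. The element b collects the
factors of later edges: F is signed only for the last state of a path, and at an intermediate state
only b · F is. -/
theorem sum_partialCoeff_mul_evalState {F : Fin D.N → B} (hF : ∀ a, F a * F a = 0) {c : Fin D.n}
    {s : D.EnhancedState} (hc : s.state c = false) {b : B}
    (hb : IsSigned o (Function.update s.state c true) fun a => b * F a) :
    ∑ t, (partialCoeff o c s t : B) * (b * evalState F t) =
      (edgeSign o c s.state (Function.update s.state c true) : B) *
        (b * edgeFactor o F c s.state * evalState F s) := by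
  have h := adjacent_update hc
  have hσ := isSigned_edge hF h hb
  set τ := Function.update s.state c true with hτ
  set P := evalOthers o F c s with hP
  have cast_sq : ∀ (σ : Fin D.n → Bool) (p : Fin 4),
      ((transport o σ c p : ℤ) : B) * ((transport o σ c p : ℤ) : B) = 1 := fun σ p => by
    exact_mod_cast congrArg (Int.cast : ℤ → B) (transport_mul_self σ c p)
  by_cases hs : D.SameCircle s.state (arcIn o c) (arcOut o c)
  · by_cases ht : D.SameCircle τ (arcIn o c) (arcOut o c)
    · rw [edgeSign, if_neg (not_not.2 hs), if_neg (not_not.2 ht), Int.cast_zero, zero_mul]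
      refine Finset.sum_eq_zero fun t _ => ?_
      by_cases h₁ : t.state = τ <;> simp [partialCoeff, hs, h₁, ht, ← hτ]
    · rw [edgeSign, if_neg (not_not.2 hs), if_pos ht]
      have ht' : ¬ D.SameCircle τ (arcOut o c) (arcIn o c) := fun e => ht e.symm
      -- Only relabellings of `s` at the site have nonzero coefficient, so the sum collapses to the
      -- labels of the two new circles.
      have key := Fintype.sum_of_injective (fun x : Bool × Bool => relabel s h o x.1 x.2)
        (fun x y e => by
          have e₁ := congrArg (fun t => EnhancedState.label t (arcIn o c)) e
          have e₂ := congrArg (fun t => EnhancedState.label t (arcOut o c)) e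
          simp [relabel, SameCircle.refl, ht'] at e₁ e₂
          exact Prod.ext e₁ e₂)
        (fun x => (partialCoeff o c s (relabel s h o x.1 x.2) : B) *
          (b * evalState F (relabel s h o x.1 x.2)))
        (fun t => (partialCoeff o c s t : B) * (b * evalState F t))
        (fun t ht => by
          by_contra hne
          refine ht ⟨(t.label (arcIn o c), t.label (arcOut o c)), ?_⟩
          refine (relabel_of_partialCoeff_ne_zero h fun e => hne ?_).symm
          simp [e])
        (fun _ => rfl)
      rw [← key]
      have pc : ∀ v w, partialCoeff o c s (relabel s h o v w) = mergeSign o c τ s.state *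
          (labelSign (transport o s.state c (underIn o c)) (s.label (arcIn o c)) *
          labelSign (transport o τ c (underIn o c)) v *
          labelSign (transport o τ c (underOut o c)) w *
          comulCoeff (s.label (arcIn o c)) v w) := by
        intro v w
        rw [partialCoeff, if_pos ⟨hc, rfl, relabel_label_off h v w⟩, if_neg (not_not.2 hs),
          if_pos (show ¬ D.SameCircle (relabel s h o v w).state _ _ from ht), mergeSign]
        simp only [relabel, SameCircle.refl, ht', if_true, if_false]
        ring
      have ev : ∀ v w, evalState F (relabel s h o v w) =
          (if v then F (D.circleOf τ (arcIn o c)) else 1) *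
          ((if w then F (D.circleOf τ (arcOut o c)) else 1) * P) := by
        intro v w
        rw [evalState_of_not_sameCircle (o := o) (c := c) ht, evalOthers_relabel h (Or.inr ht)]
        simp only [relabel, SameCircle.refl, ht', if_true, if_false]
        rfl
      have t₁ := hb.apply_circleOf_arcIn c
      have t₂ := hb.apply_circleOf_arcOut c
      have t₃ := hσ.apply_circleOf_arcIn c
      have q₁ := cast_sq τ (underIn o c)
      have q₂ := cast_sq τ (underOut o c)
      simp only [pc, ev, Fintype.sum_prod_type, Fintype.sum_bool]
      rw [evalState_of_sameCircle hs]
      simp only [edgeFactor, if_pos hs] at t₃ ⊢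
      cases hu : s.label (arcIn o c) <;>
        simp only [labelSign, comulCoeff, Bool.and_true, Bool.and_false, Bool.xor_true,
          Bool.xor_false, Bool.not_true, Bool.not_false, Bool.false_eq_true, if_true, if_false,
          one_mul, mul_one, mul_zero, zero_mul, Int.cast_zero, Int.cast_mul, add_zero, zero_add]
      -- For Δ(1) the two terms give F(in) and -F(out), the minus sign coming from the cut point.
      · linear_combination (mergeSign o c τ s.state : B) * P *
            (((transport o τ c (underIn o c) : ℤ) : B) * t₁ +
            ((transport o τ c (underOut o c) : ℤ) : B) * t₂ + b * F (arcIn o c) * q₁ -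
            b * F (arcOut o c) * q₂)
      -- For Δ(x) the product -F(in)F(out) equals (F(in) - F(out))F(in), as F(in)² = 0.
      · have sq := hF (arcIn o c)
        linear_combination (mergeSign o c τ s.state : B) * P *
          (((transport o s.state c (underIn o c) : ℤ) : B) *
            (((transport o τ c (underIn o c) : ℤ) : B) *
              ((transport o τ c (underOut o c) : ℤ) : B)) *
            (F (D.circleOf τ (arcOut o c)) * t₁ +
              ((transport o τ c (underIn o c) : ℤ) : B) * F (arcIn o c) * t₂) -
            ((transport o s.state c (underIn o c) : ℤ) : B) * b * F (arcIn o c) *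
              F (arcOut o c) * (((transport o τ c (underOut o c) : ℤ) : B) *
              ((transport o τ c (underOut o c) : ℤ) : B) * q₁ + q₂) - t₃ -
            ((transport o s.state c (underIn o c) : ℤ) : B) * b * sq)
  · have ht := sameCircle_of_not_sameCircle h hs
    have hsum := add_eq_zero_of_not_sameCircle h hs hb
    rw [edgeSign, if_pos hs]
    have key := Fintype.sum_of_injective (fun x : Bool => relabel s h o x x)
      (fun x y e => by
        have e₁ := congrArg (fun t => EnhancedState.label t (arcIn o c)) e
        simpa [relabel, SameCircle.refl] using e₁)
      (fun x => (partialCoeff o c s (relabel s h o x x) : B) *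
        (b * evalState F (relabel s h o x x)))
      (fun t => (partialCoeff o c s t : B) * (b * evalState F t))
      (fun t htt => by
        by_contra hne
        have hp : partialCoeff o c s t ≠ 0 := fun e => hne (by simp [e])
        have e := relabel_of_partialCoeff_ne_zero h hp
        have hst : t.state = τ := congrArg EnhancedState.state e
        have el : t.label (arcIn o c) = t.label (arcOut o c) := t.label_eq_of (hst ▸ ht)
        rw [← el] at e
        exact htt ⟨t.label (arcIn o c), e.symm⟩)
      (fun _ => rfl)
    rw [← key]
    have pc : ∀ v, partialCoeff o c s (relabel s h o v v) = mergeSign o c s.state τ *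
        (labelSign (transport o s.state c (underIn o c)) (s.label (arcIn o c)) *
        labelSign (transport o s.state c (underOut o c)) (s.label (arcOut o c)) *
        labelSign (transport o τ c (underIn o c)) v *
        mulCoeff (s.label (arcIn o c)) (s.label (arcOut o c)) v) := by
      intro v
      rw [partialCoeff, if_pos ⟨hc, rfl, relabel_label_off h v v⟩, if_pos hs, mergeSign]
      simp only [relabel, SameCircle.refl, if_true]
      ring
    have ev : ∀ v, evalState F (relabel s h o v v) =
        (if v then F (D.circleOf τ (arcIn o c)) else 1) * P := by
      intro v
      rw [evalState_of_sameCircle (o := o) (c := c) ht, evalOthers_relabel h (Or.inl hs)]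
      simp only [relabel, SameCircle.refl, if_true]
      rfl
    have t₁ := hσ.apply_circleOf_arcIn c
    have t₂ := hσ.apply_circleOf_arcOut c
    have t₃ := hb.apply_circleOf_arcIn c
    have q₁ := cast_sq s.state (underIn o c)
    have q₂ := cast_sq s.state (underOut o c)
    have q₃ := cast_sq τ (underIn o c)
    simp only [pc, ev, Fintype.sum_bool]
    rw [evalState_of_not_sameCircle hs]
    simp only [edgeFactor, if_neg hs, mul_one] at t₁ t₂ ⊢
    cases hu : s.label (arcIn o c) <;> cases hv : s.label (arcOut o c) <;>
      simp only [labelSign, mulCoeff, Bool.and_true, Bool.and_false, Bool.or_true,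
        Bool.or_false, Bool.true_eq_false, Bool.false_eq_true, if_true, if_false, and_true,
        and_false, one_mul, mul_one, mul_zero, zero_mul, Int.cast_zero, Int.cast_mul, add_zero,
        zero_add]
    · ring
    · linear_combination (mergeSign o c s.state τ : B) * P *
        (((transport o s.state c (underOut o c) : ℤ) : B) *
          ((transport o τ c (underIn o c) : ℤ) : B) * t₃ +
          ((transport o s.state c (underOut o c) : ℤ) : B) * b * F (arcIn o c) * q₃ - t₂ +
          ((transport o s.state c (underOut o c) : ℤ) : B) * hsum)
    · linear_combination (mergeSign o c s.state τ : B) * P *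
        (((transport o s.state c (underIn o c) : ℤ) : B) *
          ((transport o τ c (underIn o c) : ℤ) : B) * t₃ +
          ((transport o s.state c (underIn o c) : ℤ) : B) * b * F (arcIn o c) * q₃ - t₁)
    -- For x · x the values at the two under-ends are opposite after multiplication by b, so the
    -- product is a multiple of F(in)² = 0.
    · have sq := hF (arcIn o c)
      linear_combination -(mergeSign o c s.state τ : B) * P *
        (F (D.circleOf s.state (arcOut o c)) * t₁ +
          ((transport o s.state c (underIn o c) : ℤ) : B) * F (arcIn o c) * t₂ -
          ((transport o s.state c (underIn o c) : ℤ) : B) * F (arcIn o c) *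
            ((transport o s.state c (underOut o c) : ℤ) : B) * hsum +
          ((transport o s.state c (underIn o c) : ℤ) : B) *
            ((transport o s.state c (underOut o c) : ℤ) : B) * b * sq)

end Evaluation

/-! ### Faces of the cube of states -/

section Faces

variable {D : VirtualDiagram} {o : D.Orientation} {B : Type*} [CommRing B]

theorem edge_cases (o : D.Orientation) {c : Fin D.n} {σ σ' : Fin D.n → Bool}
    (h : Adjacent c σ σ') :
    (¬ D.SameCircle σ (arcIn o c) (arcOut o c) ∧ D.SameCircle σ' (arcIn o c) (arcOut o c) ∧
      (D.circles σ).card = (D.circles σ').card + 1) ∨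
    (D.SameCircle σ (arcIn o c) (arcOut o c) ∧ ¬ D.SameCircle σ' (arcIn o c) (arcOut o c) ∧
      (D.circles σ').card = (D.circles σ).card + 1) ∨
    (D.SameCircle σ (arcIn o c) (arcOut o c) ∧ D.SameCircle σ' (arcIn o c) (arcOut o c) ∧
      (D.circles σ').card = (D.circles σ).card) := by
  by_cases hs : D.SameCircle σ (arcIn o c) (arcOut o c)
  · by_cases hs' : D.SameCircle σ' (arcIn o c) (arcOut o c)
    · exact Or.inr (Or.inr ⟨hs, hs', by rw [circles_eq_of_sameCircle h hs hs']⟩)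
    · exact Or.inr (Or.inl ⟨hs, hs', card_circles_merge h.symm hs'⟩)
  · exact Or.inl ⟨hs, sameCircle_of_not_sameCircle h hs, card_circles_merge h hs⟩

/-- A square of states: `σ` and `τ` differ exactly at the two crossings `c` and `d`. -/
structure IsFace (c d : Fin D.n) (σ σc σd τ : Fin D.n → Bool) : Prop where
  ne : c ≠ d
  left : Adjacent c σ σc
  top : Adjacent d σ σd
  bottom : Adjacent d σc τ
  right : Adjacent c σd τ

variable {c d : Fin D.n} {σ σc σd τ : Fin D.n → Bool}

theorem IsFace.swap (h : IsFace c d σ σc σd τ) : IsFace d c σ σd σc τ :=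
  ⟨h.ne.symm, h.top, h.left, h.right, h.bottom⟩

theorem IsFace.reflect (h : IsFace c d σ σc σd τ) : IsFace c d σd τ σ σc :=
  ⟨h.ne, h.right, h.top.symm, h.bottom.symm, h.left⟩

theorem IsFace.opposite (h : IsFace c d σ σc σd τ) : IsFace c d τ σd σc σ :=
  ⟨h.ne, h.right.symm, h.bottom.symm, h.top.symm, h.left.symm⟩

theorem IsFace.pairing (h : IsFace c d σ σc σd τ) {f g : Fin D.N → B} (hf : IsSigned o τ f)
    (hg : IsUnsigned σ g) :
    (f (arcIn o c) + f (arcOut o c)) * (g (arcIn o c) - g (arcOut o c)) +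
      (f (arcIn o d) + f (arcOut o d)) * (g (arcIn o d) - g (arcOut o d)) = 0 := by
  refine pairing_two h.ne ?_ ?_ (fun x hc hd => ?_) hf hg
  · rw [h.top.2 c h.ne]
    exact h.right.1.symm
  · rw [h.left.2 d h.ne.symm]
    exact h.bottom.1.symm
  · rw [h.left.2 x hc, h.bottom.2 x hd]

/-- Both paths contract the same wedge by the same two functionals, in opposite orders. -/
theorem IsFace.merge_merge (h : IsFace c d σ σc σd τ)
    (h₁ : ¬ D.SameCircle σ (arcIn o c) (arcOut o c))
    (h₂ : ¬ D.SameCircle σc (arcIn o d) (arcOut o d))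
    (h₃ : ¬ D.SameCircle σ (arcIn o d) (arcOut o d))
    (h₄ : ¬ D.SameCircle σd (arcIn o c) (arcOut o c)) :
    mergeSign o c σ σc * mergeSign o d σc τ = -(mergeSign o d σ σd * mergeSign o c σd τ) := by
  have e := contractEnds_comm o c d (circleForm σ)
  rw [contractEnds_circleForm h.left h₁, contractEnds_circleForm h.top h₃, map_smul, map_smul,
    contractEnds_circleForm h.bottom h₂, contractEnds_circleForm h.right h₄, smul_smul,
    smul_smul, ← neg_smul] at e
  have := smul_circleForm_injective e
  linarith

variable (o) in
/-- The two under-ends at `c` and the two under-ends at `d` lie pairwise on the same circles, in the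
same order if `δ = 1` and in opposite orders if `δ = -1`. -/
def Parallel (σ : Fin D.n → Bool) (c d : Fin D.n) (δ : ℤ) : Prop :=
  (δ = 1 ∧ D.SameCircle σ (arcIn o c) (arcIn o d) ∧ D.SameCircle σ (arcOut o c) (arcOut o d)) ∨
    (δ = -1 ∧ D.SameCircle σ (arcIn o c) (arcOut o d) ∧ D.SameCircle σ (arcOut o c) (arcIn o d))

/-- The merge at `c` joins only its own two circles, so if it brings the two circles at `d`
together, these are the same two. -/
theorem exists_parallel (h : Adjacent c σ σc) (h₁ : ¬ D.SameCircle σ (arcIn o c) (arcOut o c))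
    (h₂ : ¬ D.SameCircle σ (arcIn o d) (arcOut o d))
    (h₃ : D.SameCircle σc (arcIn o d) (arcOut o d)) : ∃ δ, Parallel o σ c d δ := by
  rw [sameCircle_merge_iff h h₁] at h₃
  rcases h₃ with h₃ | ⟨h₃ | h₃, h₄ | h₄⟩
  · exact absurd h₃ h₂
  · exact absurd (h₃.trans h₄.symm) h₂
  · exact ⟨1, Or.inl ⟨rfl, h₃.symm, h₄.symm⟩⟩
  · exact ⟨-1, Or.inr ⟨rfl, h₄.symm, h₃.symm⟩⟩
  · exact absurd (h₃.trans h₄.symm) h₂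

theorem Parallel.sub_eq {δ : ℤ} (h : Parallel o σ c d δ) {g : Fin D.N → B}
    (hg : IsUnsigned σ g) :
    g (arcIn o c) - g (arcOut o c) = δ * (g (arcIn o d) - g (arcOut o d)) := by
  rcases h with ⟨rfl, h₁, h₂⟩ | ⟨rfl, h₁, h₂⟩ <;> rw [hg.eq h₁, hg.eq h₂] <;> push_cast <;> ring

/-- The pairing across the face, with an indicator of a circle of σ, is applied to F and to its
restriction to one of the two circles of τ. The two linear relations determine F at the ends of `d`
from F at the ends of `c`. -/
theorem Parallel.factor_eq (hf : IsFace c d σ σc σd τ) {δ ε : ℤ}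
    (hσ : ¬ D.SameCircle σ (arcIn o d) (arcOut o d)) (hδ : Parallel o σ c d δ)
    (hτ : ¬ D.SameCircle τ (arcIn o c) (arcOut o c)) (hε : Parallel o τ c d ε)
    {F : Fin D.N → B} (hF : IsSigned o τ F) :
    F (arcIn o d) - F (arcOut o d) = -(δ * ε * (F (arcIn o c) - F (arcOut o c))) := by
  have key : ∀ f : Fin D.N → B, IsSigned o τ f →
      (f (arcIn o c) + f (arcOut o c)) * δ + (f (arcIn o d) + f (arcOut o d)) = 0 := by
    intro f hf'
    have hg := isUnsigned_circleIndicator B σ (arcIn o d)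
    have := hf.pairing hf' hg
    rw [hδ.sub_eq hg] at this
    simpa [circleIndicator, SameCircle.refl, hσ] using this
  have k₁ := key F hF
  have k₂ := key _ (isSigned_mul_isUnsigned hF (isUnsigned_circleIndicator B τ (arcIn o c)))
  rcases hε with ⟨rfl, h₁, h₂⟩ | ⟨rfl, h₁, h₂⟩
  · have h₃ : ¬ D.SameCircle τ (arcIn o c) (arcOut o d) := fun e => hτ (e.trans h₂.symm)
    simp only [circleIndicator, SameCircle.refl, hτ, h₁, h₃, if_true, if_false, mul_one,
      mul_zero, add_zero] at k₂
    push_cast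
    linear_combination 2 * k₂ - k₁
  · have h₃ : ¬ D.SameCircle τ (arcIn o c) (arcIn o d) := fun e => hτ (e.trans h₂.symm)
    simp only [circleIndicator, SameCircle.refl, hτ, h₁, h₃, if_true, if_false, mul_one,
      mul_zero, add_zero, zero_add] at k₂
    push_cast
    linear_combination k₁ - 2 * k₂

/-- On the wedge of σ the contractions at `c` and `d` agree up to δ, and on that of τ up to ε.
Eliminating the wedge of σd between the two equations leaves multiples of the wedge of σc. -/
theorem Parallel.sign_eq (hf : IsFace c d σ σc σd τ) {δ ε : ℤ}
    (hσc : ¬ D.SameCircle σ (arcIn o c) (arcOut o c))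
    (hσd : ¬ D.SameCircle σ (arcIn o d) (arcOut o d)) (hδ : Parallel o σ c d δ)
    (hτc : ¬ D.SameCircle τ (arcIn o c) (arcOut o c))
    (hτd : ¬ D.SameCircle τ (arcIn o d) (arcOut o d)) (hε : Parallel o τ c d ε) :
    mergeSign o c σ σc * mergeSign o c τ σd =
      δ * ε * (mergeSign o d τ σc * mergeSign o d σ σd) := by
  have e₁ := contractEnds_circleForm_congr (o := o) (c := c) (d := d) (σ := σ) (δ := δ)
    fun g hg => by simpa using hδ.sub_eq hg
  have e₂ := contractEnds_circleForm_congr (o := o) (c := c) (d := d) (σ := τ) (δ := ε)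
    fun g hg => by simpa using hε.sub_eq hg
  rw [contractEnds_circleForm hf.left hσc, contractEnds_circleForm hf.top hσd] at e₁
  rw [contractEnds_circleForm hf.right.symm hτc, contractEnds_circleForm hf.bottom.symm hτd] at e₂
  refine smul_circleForm_injective (σ := σc) ?_
  rw [mul_comm, ← smul_smul, e₁, smul_comm (mergeSign o c τ σd), smul_comm (mergeSign o c τ σd),
    e₂]
  simp only [smul_smul]
  congr 1
  ring

theorem Parallel.sq_eq_one {δ : ℤ} (h : Parallel o σ c d δ) : δ * δ = 1 := by
  rcases h with ⟨rfl, -⟩ | ⟨rfl, -⟩ <;> rfl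

/-- The anticommutativity of the two paths along a face, for the sign of each edge and the factor by
which it multiplies. -/
theorem IsFace.anticommute (h : IsFace c d σ σc σd τ) {F : Fin D.N → B}
    (hF : IsSigned o τ F) :
    (edgeSign o c σ σc * edgeSign o d σc τ : B) * (edgeFactor o F d σc * edgeFactor o F c σ) +
      (edgeSign o d σ σd * edgeSign o c σd τ : B) *
        (edgeFactor o F c σd * edgeFactor o F d σ) = 0 := by
  have sq : ∀ x ρ ρ', ((mergeSign o x ρ ρ' : ℤ) : B) * ((mergeSign o x ρ ρ' : ℤ) : B) = 1 :=
    fun x ρ ρ' => by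
      exact_mod_cast congrArg (Int.cast : ℤ → B) (mergeSign_mul_self o x ρ ρ')
  have cast : ∀ {m n : ℤ}, m = n → (m : B) = (n : B) := fun h => congrArg _ h
  have e₁ := edge_cases o h.left
  have e₂ := edge_cases o h.bottom
  have e₃ := edge_cases o h.top
  have e₄ := edge_cases o h.right
  -- With splits read backwards, the face seen from the corner σd consists of merges only.
  have mixed : ∀ {c d : Fin D.n} {σ σc σd τ : Fin D.n → Bool}, IsFace c d σ σc σd τ →
      ¬ D.SameCircle σ (arcIn o c) (arcOut o c) → ¬ D.SameCircle τ (arcIn o d) (arcOut o d) →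
      ¬ D.SameCircle σd (arcIn o d) (arcOut o d) → ¬ D.SameCircle σd (arcIn o c) (arcOut o c) →
      (mergeSign o c σ σc * mergeSign o d τ σc : B) +
        (mergeSign o d σd σ * mergeSign o c σd τ : B) = 0 := by
    intro c d σ σc σd τ h h₁ h₂ h₃ h₄
    have := cast (h.reflect.merge_merge h₄ h₂ h₃ h₁)
    push_cast at this
    linear_combination (mergeSign o c σ σc : B) * (mergeSign o c σd τ : B) * this -
      (mergeSign o c σ σc * mergeSign o d τ σc : B) * sq c σd τ -
      (mergeSign o d σd σ * mergeSign o c σd τ : B) * sq c σ σc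
  -- A one-to-one change at `d` leaves the circles unchanged, so it cannot affect whether `c` sees
  -- one circle or two.
  have none : ∀ {c d : Fin D.n} {σ σc σd τ : Fin D.n → Bool}, IsFace c d σ σc σd τ →
      D.SameCircle σ (arcIn o d) (arcOut o d) → D.SameCircle σd (arcIn o d) (arcOut o d) →
      D.SameCircle σd (arcIn o c) (arcOut o c) → D.SameCircle σ (arcIn o c) (arcOut o c) := by
    intro c d σ σc σd τ h h₁ h₂ h₃
    exact (sameCircle_iff_of_sameCircle h.top h₁ h₂).2 h₃
  -- A split followed by a merge may face two one-to-one changes, whose path is zero; then the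
  -- factor of the split must vanish. Comparing F on σc with an orientation f of the circle of σ,
  -- which takes equal values at the ends of `d` and opposite ones at the ends of `c`, reduces this
  -- to F(in) + F(out) = 0 at `d`.
  have single : ∀ {c d : Fin D.n} {σ σc σd τ : Fin D.n → Bool}, IsFace c d σ σc σd τ →
      IsSigned o τ F → D.SameCircle σ (arcIn o d) (arcOut o d) →
      ¬ D.SameCircle σc (arcIn o c) (arcOut o c) → ¬ D.SameCircle σc (arcIn o d) (arcOut o d) →
      D.SameCircle σd (arcIn o d) (arcOut o d) → F (arcIn o c) - F (arcOut o c) = 0 := by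
    intro c d σ σc σd τ h hF h₁ h₂ h₃ h₄
    obtain ⟨δ, hδ⟩ := exists_parallel h.left.symm h₂ h₃ h₁
    have hd := add_eq_zero_of_not_sameCircle h.bottom h₃ hF
    have hF' := isSigned_adjacent h.bottom.symm hF hd
    obtain ⟨f, hf₁, hf⟩ := exists_isSigned o σ (arcIn o c)
    have hfd := eq_of_sameCircle_of_sameCircle h.top h₁ h₄ hf
    have hfc := add_eq_zero_of_not_sameCircle h.left.symm h₂ hf
    have hf' := isSigned_adjacent h.left hf hfc
    have hfB : IsSigned o σc fun a => (f a : B) := by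
      intro x p
      have := hf' x p
      simp only [endValue] at this ⊢
      split_ifs at this ⊢ <;> exact_mod_cast congrArg (Int.cast : ℤ → B) this
    have hu := isUnsigned_signed_mul_signed hF' hfB
    have hout : f (arcOut o c) = -1 := by rw [hf₁] at hfc; linarith
    rcases hδ with ⟨-, h₅, h₆⟩ | ⟨-, h₅, h₆⟩
    · have i₁ := hu.eq h₅
      have i₂ := hu.eq h₆
      simp only [hf₁, hout, hfd] at i₁ i₂
      push_cast at i₁ i₂
      linear_combination i₁ + i₂ + (f (arcOut o d) : B) * hd
    · have i₁ := hu.eq h₅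
      have i₂ := hu.eq h₆
      simp only [hf₁, hout, hfd] at i₁ i₂
      push_cast at i₁ i₂
      linear_combination i₁ + i₂ + (f (arcOut o d) : B) * hd
  -- Counting circles excludes the combinations whose two paths disagree, and faces with a
  -- one-to-one change on both paths are trivial. Ten cases remain.
  rcases e₁ with ⟨a₁, b₁, n₁⟩ | ⟨a₁, b₁, n₁⟩ | ⟨a₁, b₁, n₁⟩ <;>
  rcases e₂ with ⟨a₂, b₂, n₂⟩ | ⟨a₂, b₂, n₂⟩ | ⟨a₂, b₂, n₂⟩ <;>
  rcases e₃ with ⟨a₃, b₃, n₃⟩ | ⟨a₃, b₃, n₃⟩ | ⟨a₃, b₃, n₃⟩ <;>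
  rcases e₄ with ⟨a₄, b₄, n₄⟩ | ⟨a₄, b₄, n₄⟩ | ⟨a₄, b₄, n₄⟩ <;>
  first
  | (exfalso; omega)
  | skip
  all_goals simp only [edgeSign, edgeFactor, a₁, b₁, a₂, b₂, a₃, b₃, a₄, b₄, not_true_eq_false,
      not_false_eq_true, if_true, if_false, Int.cast_zero, mul_zero, zero_mul, add_zero, zero_add,
      mul_one, one_mul]
  · have := cast (h.merge_merge a₁ a₂ a₃ a₄)
    push_cast at this
    linear_combination this
  -- Merge then split on both paths: the signs of the paths compare by δε and their factors by -δε.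
  · obtain ⟨δ, hδ⟩ := exists_parallel h.left a₁ a₃ a₂
    obtain ⟨ε, hε⟩ := exists_parallel h.right.symm b₄ b₂ b₃
    have e := cast (hδ.sign_eq h a₁ a₃ b₄ b₂ hε)
    have e' := hδ.factor_eq h a₃ b₄ hε hF
    have q₁ := cast hδ.sq_eq_one
    have q₂ := cast hε.sq_eq_one
    have q₃ := sq d τ σc
    have q₄ := sq c τ σd
    push_cast at e q₁ q₂
    linear_combination (mergeSign o c σ σc : B) * (mergeSign o d τ σc : B) * e' +
      (F (arcIn o c) - F (arcOut o c)) *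
        (-(δ : B) * (ε : B) * (mergeSign o d τ σc : B) * (mergeSign o c τ σd : B) * e +
          (δ : B) * (ε : B) * (mergeSign o c σ σc : B) * (mergeSign o d τ σc : B) * q₄ -
          (mergeSign o d σ σd : B) * (mergeSign o c τ σd : B) *
            ((ε : B) * (ε : B) * (mergeSign o d τ σc : B) * (mergeSign o d τ σc : B) * q₁ +
              (mergeSign o d τ σc : B) * (mergeSign o d τ σc : B) * q₂ + q₃))
  · linear_combination (F (arcIn o d) - F (arcOut o d)) * mixed h a₁ b₂ b₃ a₄
  · exact absurd (none h a₃ b₃ a₄) a₁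
  · linear_combination (F (arcIn o c) - F (arcOut o c)) * mixed h.swap a₃ b₄ b₁ a₂
  -- Split then merge on both paths: the same argument with σc and σd as the two-circle corners. F
  -- is signed for σd too, since the edge from σd to τ is a merge.
  · have h' : IsFace c d σc σ τ σd := ⟨h.ne, h.left.symm, h.bottom, h.top, h.right.symm⟩
    have hF' := isSigned_adjacent h.right.symm hF (add_eq_zero_of_not_sameCircle h.right a₄ hF)
    obtain ⟨δ, hδ⟩ := exists_parallel h'.left b₁ a₂ a₃
    obtain ⟨ε, hε⟩ := exists_parallel h.right a₄ b₃ b₂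
    have e := cast (hδ.sign_eq h' b₁ a₂ a₄ b₃ hε)
    have e' := hδ.factor_eq h' a₂ a₄ hε hF'
    have q₁ := cast hδ.sq_eq_one
    have q₂ := cast hε.sq_eq_one
    have q₃ := sq d σc τ
    have q₄ := sq c σd τ
    push_cast at e q₁ q₂
    linear_combination (mergeSign o d σd σ : B) * (mergeSign o c σd τ : B) * e' +
      (F (arcIn o c) - F (arcOut o c)) *
        ((mergeSign o d σc τ : B) * (mergeSign o c σd τ : B) * e -
          (mergeSign o c σc σ : B) * (mergeSign o d σc τ : B) * q₄ +
          (δ : B) * (ε : B) * (mergeSign o d σd σ : B) * (mergeSign o c σd τ : B) * q₃)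
  · rw [single h hF a₃ b₁ a₂ b₃, mul_zero]
  · have := cast (h.opposite.merge_merge b₄ b₃ b₂ b₁)
    push_cast at this
    linear_combination (F (arcIn o d) - F (arcOut o d)) * (F (arcIn o c) - F (arcOut o c)) * this
  · exact absurd (none h.swap a₁ b₁ a₂) a₃
  · rw [single h.swap hF a₁ b₃ a₄ b₁, mul_zero]

end Faces

/-! ### A universal signed function with square zero values -/

section Universal

variable {D : VirtualDiagram}

open MvPolynomial in
-- Take one variable X_K for each circle K, impose X_K² = 0, and let F(a) be ±X_K according to an
-- orientation of K that is 1 at the base point. Enhanced states over τ then evaluate to distinct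
-- squarefree monomials, which are linearly independent.
theorem exists_universal_signed (o : D.Orientation) (τ : Fin D.n → Bool) :
    ∃ (B : Type) (_ : CommRing B) (F : Fin D.N → B), IsSigned o τ F ∧ (∀ a, F a * F a = 0) ∧
      ∀ x : D.EnhancedState → ℤ, (∀ t, t.state ≠ τ → x t = 0) →
        ∑ t, (x t : B) * evalState F t = 0 → ∀ t, x t = 0 := by
  let I : Ideal (MvPolynomial (Fin D.N) ℤ) :=
    Ideal.span ((fun m => monomial m (1 : ℤ)) '' (Set.range fun a : Fin D.N => Finsupp.single a 2))
  choose f hf₁ hf using fun K => exists_isSigned o τ K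
  let G : Fin D.N → MvPolynomial (Fin D.N) ℤ :=
    fun a => (f (D.circleOf τ a) a : MvPolynomial (Fin D.N) ℤ) * X (D.circleOf τ a)
  let F : Fin D.N → MvPolynomial (Fin D.N) ℤ ⧸ I := fun a => Ideal.Quotient.mk I (G a)
  let m : D.EnhancedState → Fin D.N →₀ ℕ := fun t =>
    ∑ a ∈ D.circles t.state, if t.label a then Finsupp.single a 1 else 0
  have hm : ∀ t K, m t K = if K ∈ D.circles t.state ∧ t.label K then 1 else 0 := by
    intro t K
    simp only [m, Finsupp.finsetSum_apply]
    by_cases hK : K ∈ D.circles t.state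
    · rw [Finset.sum_eq_single_of_mem K hK fun b _ hb => by split_ifs <;> simp [hb]]
      by_cases hl : t.label K <;> simp [hK, hl]
    · rw [Finset.sum_eq_zero fun b hb => by
        have : b ≠ K := fun e => hK (e ▸ hb)
        split_ifs <;> simp [this]]
      simp [hK]
  refine ⟨_, inferInstance, F, ?_, ?_, ?_⟩
  · intro c p
    have h := hf (D.circleOf τ (D.arc c p)) c p
    have e := circleOf_partner τ c p
    have key : ∀ q, D.circleOf τ (D.arc c q) = D.circleOf τ (D.arc c p) → endValue o F c q =
        Ideal.Quotient.mk I (((endValue o (f (D.circleOf τ (D.arc c p))) c q : ℤ) :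
          MvPolynomial (Fin D.N) ℤ) * X (D.circleOf τ (D.arc c p))) := by
      intro q hq
      simp only [endValue, F, G, hq]
      split_ifs <;> simp
    rw [key _ e.symm, key p rfl, h]
    simp
  · intro a
    have : G a * G a = ((f (D.circleOf τ a) a * f (D.circleOf τ a) a : ℤ) :
        MvPolynomial (Fin D.N) ℤ) * monomial (Finsupp.single (D.circleOf τ a) 2) 1 := by
      have : (monomial (Finsupp.single (D.circleOf τ a) 2) (1 : ℤ)) =
          X (D.circleOf τ a) * X (D.circleOf τ a) := by
        rw [← sq, X_pow_eq_monomial]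
      rw [this]
      simp only [G]
      push_cast
      ring
    simp only [F, ← map_mul]
    rw [Ideal.Quotient.eq_zero_iff_mem, this]
    exact I.mul_mem_left _ (Ideal.subset_span ⟨_, ⟨_, rfl⟩, rfl⟩)
  · intro x hx hsum t₀
    by_contra hne
    have hev : ∀ t : D.EnhancedState, t.state = τ →
        evalState F t = Ideal.Quotient.mk I (monomial (m t) 1) := by
      intro t ht
      simp only [m]
      rw [monomial_sum_one, map_prod, evalState]
      refine Finset.prod_congr rfl fun a ha => ?_
      rw [ht, mem_circles_iff] at ha
      split_ifs
      · have h₁ := hf₁ a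
        simp only [F, G, ha, h₁]
        simp [X]
      · rw [← C_apply, C_1, map_one]
    have hp : (∑ t, C (x t) * monomial (m t) (1 : ℤ)) ∈ I := by
      rw [← Ideal.Quotient.eq_zero_iff_mem, map_sum, ← hsum]
      refine Finset.sum_congr rfl fun t _ => ?_
      by_cases ht : t.state = τ
      · rw [map_mul, hev t ht]
        congr 1
      · simp [hx t ht]
    have hinj : ∀ t t' : D.EnhancedState, t.state = τ → t'.state = τ → m t = m t' → t = t' := by
      intro t t' ht ht' e
      refine EnhancedState.ext_of (ht.trans ht'.symm) fun a => ?_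
      have e' := DFunLike.congr_fun e (D.circleOf τ a)
      rw [hm, hm, ht, ht'] at e'
      simp only [circleOf_mem_circles, true_and] at e'
      rw [t.label_eq_of (b := D.circleOf τ a) (by rw [ht]; exact sameCircle_circleOf τ a),
        t'.label_eq_of (b := D.circleOf τ a) (by rw [ht']; exact sameCircle_circleOf τ a)]
      revert e'
      cases t.label (D.circleOf τ a) <;> cases t'.label (D.circleOf τ a) <;> simp
    have ht₀ : t₀.state = τ := by
      by_contra h
      exact hne (hx t₀ h)
    have hcoeff : coeff (m t₀) (∑ t, C (x t) * monomial (m t) (1 : ℤ)) = x t₀ := by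
      rw [coeff_sum, Finset.sum_eq_single t₀]
      · rw [coeff_C_mul, coeff_monomial, if_pos rfl, mul_one]
      · intro t _ ht
        by_cases h : t.state = τ
        · have : m t ≠ m t₀ := fun e => ht (hinj t t₀ h ht₀ e)
          rw [coeff_C_mul, coeff_monomial, if_neg this, mul_zero]
        · simp [hx t h]
      · simp
    -- A monomial in the ideal is divisible by some X_K², whereas the exponents of `m t₀` are at
    -- most 1.
    obtain ⟨-, ⟨K, rfl⟩, hK⟩ := mem_ideal_span_monomial_image.1 hp (m t₀)
      (by rw [mem_support_iff, hcoeff]; exact hne)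
    have := hK K
    rw [hm, Finsupp.single_eq_same] at this
    split_ifs at this <;> omega

end Universal

/-! ### The differential squares to zero -/

section SquareZero

variable {D : VirtualDiagram} {o : D.Orientation}

theorem state_of_partialCoeff_ne_zero {c : Fin D.n} {s t : D.EnhancedState}
    (h : partialCoeff o c s t ≠ 0) :
    s.state c = false ∧ t.state = Function.update s.state c true := by
  by_contra h'
  refine h ?_
  rw [partialCoeff, if_neg]
  tauto

theorem sum_sum_partialCoeff_mul_evalState {B : Type*} [CommRing B] {F : Fin D.N → B}
    (hF : ∀ a, F a * F a = 0) {c d : Fin D.n} (hcd : c ≠ d) {s : D.EnhancedState}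
    (hc : s.state c = false) (hd : s.state d = false)
    (hτ : IsSigned o (Function.update (Function.update s.state c true) d true) F) :
    ∑ t, ((∑ u, partialCoeff o c s u * partialCoeff o d u t : ℤ) : B) * evalState F t =
      (edgeSign o c s.state (Function.update s.state c true) *
        edgeSign o d (Function.update s.state c true)
          (Function.update (Function.update s.state c true) d true) : B) *
      (edgeFactor o F d (Function.update s.state c true) * edgeFactor o F c s.state) *
        evalState F s := by
  have hd' : Function.update s.state c true d = false := by
    rw [Function.update_of_ne hcd.symm, hd]
  have hτ' : IsSigned o (Function.update (Function.update s.state c true) d true)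
      fun a => (1 : B) * F a := by simpa using hτ
  have h₁ : ∀ u, (partialCoeff o c s u : B) * ∑ t, (partialCoeff o d u t : B) * evalState F t =
      (edgeSign o d (Function.update s.state c true)
          (Function.update (Function.update s.state c true) d true) : B) *
        ((partialCoeff o c s u : B) *
          (1 * edgeFactor o F d (Function.update s.state c true) * evalState F u)) := by
    intro u
    by_cases h : partialCoeff o c s u = 0
    · simp [h]
    · have hu := (state_of_partialCoeff_ne_zero h).2
      have := sum_partialCoeff_mul_evalState (o := o) hF (c := d) (s := u) (b := (1 : B))
        (by rw [hu, hd']) (by rw [hu]; exact hτ')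
      rw [hu] at this
      simp only [one_mul] at this ⊢
      rw [this]
      ring
  have h₂ := sum_partialCoeff_mul_evalState (o := o) hF hc
    (isSigned_edge hF (adjacent_update hd') hτ')
  calc ∑ t, ((∑ u, partialCoeff o c s u * partialCoeff o d u t : ℤ) : B) * evalState F t
      = ∑ u, (partialCoeff o c s u : B) * ∑ t, (partialCoeff o d u t : B) * evalState F t := by
        push_cast
        simp only [Finset.sum_mul, Finset.mul_sum]
        rw [Finset.sum_comm]
        simp only [mul_assoc]
    _ = _ := by
        simp only [h₁]
        rw [← Finset.mul_sum, h₂]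
        ring

/-- Both composites end in the same state τ, so the universal evaluation over τ detects their sum,
and there the claim is the anticommutativity of signs and factors along the face. -/
theorem sum_partialCoeff_anticommute (c d : Fin D.n) (s t : D.EnhancedState) :
    ∑ u, partialCoeff o c s u * partialCoeff o d u t +
      ∑ u, partialCoeff o d s u * partialCoeff o c u t = 0 := by
  have hstate : ∀ {c d : Fin D.n} {t : D.EnhancedState},
      ∑ u, partialCoeff o c s u * partialCoeff o d u t ≠ 0 → c ≠ d ∧ s.state c = false ∧
        s.state d = false ∧
        t.state = Function.update (Function.update s.state c true) d true := by
    intro c d t h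
    obtain ⟨u, -, hu⟩ := Finset.exists_ne_zero_of_sum_ne_zero h
    obtain ⟨h₁, h₂⟩ := state_of_partialCoeff_ne_zero (left_ne_zero_of_mul hu)
    obtain ⟨h₃, h₄⟩ := state_of_partialCoeff_ne_zero (right_ne_zero_of_mul hu)
    have hcd : c ≠ d := by
      rintro rfl
      rw [h₂, Function.update_self] at h₃
      exact Bool.noConfusion h₃
    refine ⟨hcd, h₁, ?_, by rw [h₄, h₂]⟩
    rwa [h₂, Function.update_of_ne hcd.symm] at h₃
  by_cases hcd : c ≠ d ∧ s.state c = false ∧ s.state d = false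
  · obtain ⟨hcd, hc, hd⟩ := hcd
    set σc := Function.update s.state c true with hσc
    set σd := Function.update s.state d true with hσd
    set τ := Function.update σc d true with hτ
    have hτ' : τ = Function.update σd c true := by
      rw [hτ, hσc, hσd, Function.update_comm hcd]
    obtain ⟨B, _, F, hF, hF₂, hinj⟩ := exists_universal_signed o τ
    refine hinj (fun t => ∑ u, partialCoeff o c s u * partialCoeff o d u t +
      ∑ u, partialCoeff o d s u * partialCoeff o c u t) ?_ ?_ t
    · intro t ht
      have h₁ : ∑ u, partialCoeff o c s u * partialCoeff o d u t = 0 := by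
        by_contra h
        exact ht (hstate h).2.2.2
      have h₂ : ∑ u, partialCoeff o d s u * partialCoeff o c u t = 0 := by
        by_contra h
        exact ht (hτ' ▸ (hstate h).2.2.2)
      simp only [h₁, h₂, add_zero]
    · have face : IsFace c d s.state σc σd τ :=
        ⟨hcd, adjacent_update hc, adjacent_update hd,
          adjacent_update (by rw [hσc, Function.update_of_ne hcd.symm, hd]),
          hτ' ▸ adjacent_update (by rw [hσd, Function.update_of_ne hcd, hc])⟩
      have e₁ := sum_sum_partialCoeff_mul_evalState hF₂ hcd hc hd hF
      have e₂ := sum_sum_partialCoeff_mul_evalState (o := o) hF₂ hcd.symm hd hc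
        (by rw [← hσd, ← hτ']; exact hF)
      rw [← hσd, ← hτ'] at e₂
      rw [← hσc, ← hτ] at e₁
      simp only [Int.cast_add, add_mul, Finset.sum_add_distrib]
      rw [e₁, e₂, ← add_mul, face.anticommute hF, zero_mul]
  · have h₁ : ∑ u, partialCoeff o c s u * partialCoeff o d u t = 0 := by
      by_contra h
      have := hstate h
      exact hcd ⟨this.1, this.2.1, this.2.2.1⟩
    have h₂ : ∑ u, partialCoeff o d s u * partialCoeff o c u t = 0 := by
      by_contra h
      have := hstate h
      exact hcd ⟨this.1.symm, this.2.2.1, this.2.1⟩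
    rw [h₁, h₂, add_zero]

theorem differential_comp_differential (k : Type*) [CommRing k] (o : D.Orientation) :
    differential k o ∘ₗ differential k o = 0 := by
  unfold differential
  rw [← Matrix.mulVecLin_mul]
  refine (congrArg Matrix.mulVecLin ?_).trans Matrix.mulVecLin_zero
  ext t s
  rw [Matrix.mul_apply, Matrix.zero_apply]
  simp only [Matrix.of_apply]
  have key : ∑ u, (∑ d, partialCoeff o d u t) * (∑ c, partialCoeff o c s u) = 0 := by
    have e : ∑ u, (∑ d, partialCoeff o d u t) * (∑ c, partialCoeff o c s u) =
        ∑ c, ∑ d, ∑ u, partialCoeff o c s u * partialCoeff o d u t := by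
      simp only [Finset.sum_mul_sum]
      rw [Finset.sum_comm, Finset.sum_congr rfl fun d _ => Finset.sum_comm, Finset.sum_comm]
      exact Finset.sum_congr rfl fun c _ => Finset.sum_congr rfl fun d _ =>
        Finset.sum_congr rfl fun u _ => mul_comm _ _
    have e' : ∑ c, ∑ d, ∑ u, partialCoeff o c s u * partialCoeff o d u t =
        ∑ c, ∑ d, ∑ u, partialCoeff o d s u * partialCoeff o c u t := Finset.sum_comm
    have h : ∑ c, ∑ d, (∑ u, partialCoeff o c s u * partialCoeff o d u t +
        ∑ u, partialCoeff o d s u * partialCoeff o c u t) = 0 :=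
      Finset.sum_eq_zero fun c _ => Finset.sum_eq_zero fun d _ =>
        sum_partialCoeff_anticommute c d s t
    -- Symmetrizing over (c, d) shows that twice the sum vanishes. The factor 2 is cancelled over ℤ,
    -- before passing to `k`, where 2 may be zero.
    simp only [Finset.sum_add_distrib] at h
    rw [e]
    omega
  exact_mod_cast congrArg (Int.cast : ℤ → k) key

end SquareZero

/-! ### The bidegree of the differential -/

section Bidegree

variable {D : VirtualDiagram} {o : D.Orientation}

theorem numB_update {σ : Fin D.n → Bool} {c : Fin D.n} (h : σ c = false) :
    numB (D := D) (Function.update σ c true) = numB (D := D) σ + 1 := by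
  unfold numB
  have : (Finset.univ.filter fun x => Function.update σ c true x = true) =
      insert c (Finset.univ.filter fun x => σ x = true) := by
    ext x
    by_cases hx : x = c <;> simp [hx]
  rw [this, Finset.card_insert_of_notMem (by simp [h])]

/-- The quantum degree of a label. -/
def labelDegree (b : Bool) : ℤ := if b then -1 else 1

theorem qDegree_of_sameCircle {c : Fin D.n} {s : D.EnhancedState}
    (hs : D.SameCircle s.state (arcIn o c) (arcOut o c)) : s.qDegree =
      numB s.state + (labelDegree (s.label (arcIn o c)) +
        ∑ a ∈ otherCircles o s.state c, labelDegree (s.label a)) := by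
  obtain ⟨h₁, h₂⟩ := circles_eq_cons hs
  rw [EnhancedState.qDegree, h₁, Finset.sum_insert h₂,
    ← s.label_eq_of (sameCircle_circleOf s.state (arcIn o c))]
  rfl

theorem qDegree_of_not_sameCircle {c : Fin D.n} {s : D.EnhancedState}
    (hs : ¬ D.SameCircle s.state (arcIn o c) (arcOut o c)) : s.qDegree =
      numB s.state + (labelDegree (s.label (arcIn o c)) + (labelDegree (s.label (arcOut o c)) +
        ∑ a ∈ otherCircles o s.state c, labelDegree (s.label a))) := by
  obtain ⟨h₁, h₂, h₃⟩ := circles_eq_cons_cons hs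
  rw [EnhancedState.qDegree, h₁, Finset.sum_insert h₂, Finset.sum_insert h₃,
    ← s.label_eq_of (sameCircle_circleOf s.state (arcIn o c)),
    ← s.label_eq_of (sameCircle_circleOf s.state (arcOut o c))]
  rfl

/-- Multiplication and comultiplication lower the label degree by 1, which the additional
B-smoothing makes up for. -/
theorem degrees_of_partialCoeff_ne_zero {c : Fin D.n} {s t : D.EnhancedState}
    (h : partialCoeff o c s t ≠ 0) :
    numB t.state = numB s.state + 1 ∧ t.qDegree = s.qDegree := by
  have hcond : s.state c = false ∧ t.state = Function.update s.state c true ∧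
      ∀ a, ¬ D.SameCircle s.state a (arcIn o c) → ¬ D.SameCircle s.state a (arcOut o c) →
        t.label a = s.label a := by
    by_contra h₁
    rw [partialCoeff, if_neg h₁] at h
    exact h rfl
  obtain ⟨hc, ht, hl⟩ := hcond
  have hadj : Adjacent c s.state t.state := ht ▸ adjacent_update hc
  have hB : numB (D := D) t.state = numB (D := D) s.state + 1 := by rw [ht, numB_update hc]
  refine ⟨hB, ?_⟩
  have hothers : otherCircles o t.state c = otherCircles o s.state c →
      ∑ a ∈ otherCircles o t.state c, labelDegree (t.label a) =
        ∑ a ∈ otherCircles o s.state c, labelDegree (s.label a) := by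
    intro e
    rw [e]
    refine Finset.sum_congr rfl fun a ha => ?_
    obtain ⟨-, h₁, h₂⟩ := mem_otherCircles.1 ha
    rw [hl a h₁ h₂]
  rw [partialCoeff, if_pos ⟨hc, ht, hl⟩] at h
  by_cases hs : D.SameCircle s.state (arcIn o c) (arcOut o c)
  · rw [if_neg (not_not.2 hs)] at h
    by_cases hs' : D.SameCircle t.state (arcIn o c) (arcOut o c)
    · rw [if_neg (not_not.2 hs')] at h
      exact absurd rfl h
    · rw [if_pos hs'] at h
      have hm := right_ne_zero_of_mul h
      rw [qDegree_of_sameCircle hs, qDegree_of_not_sameCircle hs', hB,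
        hothers (otherCircles_merge hadj.symm hs').symm]
      revert hm
      cases s.label (arcIn o c) <;> cases t.label (arcIn o c) <;> cases t.label (arcOut o c) <;>
        simp [comulCoeff, labelDegree] <;> ring
  · rw [if_pos hs] at h
    have hm := right_ne_zero_of_mul h
    rw [qDegree_of_not_sameCircle hs,
      qDegree_of_sameCircle (sameCircle_of_not_sameCircle hadj hs), hB,
      hothers (otherCircles_merge hadj hs)]
    revert hm
    cases s.label (arcIn o c) <;> cases s.label (arcOut o c) <;> cases t.label (arcIn o c) <;>
      simp [mulCoeff, labelDegree] <;> ring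

theorem map_bracketChain_le (k : Type*) [CommRing k] (o : D.Orientation) (i j : ℚ) :
    (bracketChain D k i j).map (differential k o) ≤ bracketChain D k (i + 1) j := by
  rw [bracketChain, Submodule.map_span_le]
  rintro f ⟨s, hi, hj, rfl⟩
  have e : differential k o (Pi.single s 1) =
      ∑ t, ((∑ c, partialCoeff o c s t : ℤ) : k) • (Pi.single t 1 : D.EnhancedState → k) := by
    ext t
    rw [Finset.sum_apply, Finset.sum_eq_single t (fun b _ hb => by simp [hb.symm])
      (by simp)]
    simp [differential, Matrix.mulVec_single]
  rw [e]
  refine Submodule.sum_mem _ fun t _ => ?_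
  by_cases h : ∑ c, partialCoeff o c s t = 0
  · rw [h, Int.cast_zero, zero_smul]
    exact Submodule.zero_mem _
  · obtain ⟨c, -, hc⟩ := Finset.exists_ne_zero_of_sum_ne_zero h
    obtain ⟨h₁, h₂⟩ := degrees_of_partialCoeff_ne_zero hc
    refine Submodule.smul_mem _ _ (Submodule.subset_span ⟨t, ?_, ?_, rfl⟩)
    · rw [h₁, Nat.cast_add, hi, Nat.cast_one]
    · rw [h₂, hj]

theorem map_unorientedChain_le (k : Type*) [CommRing k] (o : D.Orientation) (i j : ℚ) :
    (unorientedChain k o i j).map (differential k o) ≤ unorientedChain k o (i + 1) j := by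
  have := map_bracketChain_le k o (i - (-(sMinus o : ℚ) - (D.mixedNumber : ℚ) / 2))
    (j - ((sPlus o : ℚ) - 2 * sMinus o - (D.mixedNumber : ℚ) / 2))
  rwa [sub_add_eq_add_sub] at this

end Bidegree

/-! ### Ranks of chains, cycles, boundaries and homology -/

section Ranks

open Module

/-- Submodules of the chain module need not be finitely generated over a general domain, so
finiteness is asked of the cardinal rank only. -/
theorem finrank_quotient_add_finrank_of_rank_lt {R M : Type*} [CommRing R] [IsDomain R]
    [AddCommGroup M] [Module R M] (hM : Module.rank R M < Cardinal.aleph0) (N : Submodule R M) :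
    finrank R (M ⧸ N) + finrank R N = finrank R M := by
  have h := rank_quotient_add_rank_of_isDomain N
  have h₁ : Module.rank R (M ⧸ N) < Cardinal.aleph0 :=
    lt_of_le_of_lt (h ▸ self_le_add_right _ _) hM
  have h₂ : Module.rank R N < Cardinal.aleph0 := lt_of_le_of_lt (h ▸ self_le_add_left _ _) hM
  rw [finrank, finrank, finrank, ← h, Cardinal.toNat_add h₁ h₂]

theorem finrank_map_add_finrank_ker_inf {R M : Type*} [CommRing R] [IsDomain R]
    [AddCommGroup M] [Module R M] [Module.Finite R M] (f : M →ₗ[R] M) (N : Submodule R M) :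
    finrank R (N.map f) + finrank R ↥(LinearMap.ker f ⊓ N) = finrank R N := by
  have hN : Module.rank R N < Cardinal.aleph0 :=
    lt_of_le_of_lt (Submodule.rank_le N) (rank_lt_aleph0 R M)
  have h := finrank_quotient_add_finrank_of_rank_lt hN (LinearMap.ker (f.domRestrict N))
  rw [(f.domRestrict N).quotKerEquivRange.finrank_eq, LinearMap.range_domRestrict] at h
  rw [← h]
  congr 1
  have e : LinearMap.ker f ⊓ N = (LinearMap.ker (f.domRestrict N)).map N.subtype := by
    ext x
    simp only [Submodule.mem_inf, LinearMap.mem_ker, Submodule.mem_map, Submodule.subtype_apply,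
      LinearMap.domRestrict_apply]
    constructor
    · rintro ⟨h₁, h₂⟩
      exact ⟨⟨x, h₂⟩, h₁, rfl⟩
    · rintro ⟨y, h₁, rfl⟩
      exact ⟨h₁, y.2⟩
  rw [e]
  exact ((LinearMap.ker (f.domRestrict N)).equivMapOfInjective _ N.injective_subtype).finrank_eq.symm

theorem finrank_quotient_submoduleOf {R M : Type*} [CommRing R] [IsDomain R]
    [AddCommGroup M] [Module R M] [Module.Finite R M] {N P : Submodule R M} (h : N ≤ P) :
    finrank R (P ⧸ N.submoduleOf P) + finrank R N = finrank R P := by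
  have hP : Module.rank R P < Cardinal.aleph0 :=
    lt_of_le_of_lt (Submodule.rank_le P) (rank_lt_aleph0 R M)
  rw [← finrank_quotient_add_finrank_of_rank_lt hP (N.submoduleOf P),
    (Submodule.submoduleOfEquivOfLe h).finrank_eq]

variable {D : VirtualDiagram} (k : Type*) [CommRing k]

/-- The homological degree of an enhanced state in the unoriented complex. -/
def homDegree (o : D.Orientation) (s : D.EnhancedState) : ℚ :=
  numB s.state + (-(sMinus o : ℚ) - (D.mixedNumber : ℚ) / 2)

/-- The quantum degree of an enhanced state in the unoriented complex. -/
def quantumDegree (o : D.Orientation) (s : D.EnhancedState) : ℚ :=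
  s.qDegree + ((sPlus o : ℚ) - 2 * sMinus o - (D.mixedNumber : ℚ) / 2)

theorem unorientedChain_eq_span (o : D.Orientation) (i j : ℚ) : unorientedChain k o i j =
    Submodule.span k (Set.range fun s : {s : D.EnhancedState // homDegree o s = i ∧
      quantumDegree o s = j} => (Pi.single s.1 1 : D.EnhancedState → k)) := by
  rw [unorientedChain, bracketChain]
  congr 1
  ext f
  constructor
  · rintro ⟨s, h₁, h₂, rfl⟩
    exact ⟨⟨s, by rw [homDegree, h₁]; ring, by rw [quantumDegree, h₂]; ring⟩, rfl⟩
  · rintro ⟨⟨s, h₁, h₂⟩, rfl⟩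
    exact ⟨s, by rw [← h₁, homDegree]; ring, by rw [← h₂, quantumDegree]; ring, rfl⟩

theorem finrank_unorientedChain [Nontrivial k] (o : D.Orientation) (i j : ℚ) :
    finrank k (unorientedChain k o i j) =
      (Finset.univ.filter fun s => homDegree o s = i ∧ quantumDegree o s = j).card := by
  have hli : LinearIndependent k fun s : {s : D.EnhancedState // homDegree o s = i ∧
      quantumDegree o s = j} => (Pi.single s.1 1 : D.EnhancedState → k) := by
    have h := (Pi.basisFun k D.EnhancedState).linearIndependent.comp
      (fun s : {s : D.EnhancedState // homDegree o s = i ∧ quantumDegree o s = j} => s.1)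
      Subtype.val_injective
    convert h using 1
    ext s t
    simp
  rw [unorientedChain_eq_span, finrank_span_eq_card hli, Fintype.card_subtype]

theorem boundaries_le_cycles (o : D.Orientation) (i j : ℚ) :
    boundaries k o i j ≤ cycles k o i j := by
  refine le_inf ?_ ?_
  · rintro _ ⟨x, -, rfl⟩
    exact LinearMap.congr_fun (differential_comp_differential k o) x
  · have := map_unorientedChain_le k o (i - 1) j
    rwa [sub_add_cancel] at this

theorem finrank_unorientedKh [IsDomain k] (o : D.Orientation) (i j : ℚ) :
    finrank k (UnorientedKh k o i j) + finrank k (boundaries k o i j) +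
      finrank k (boundaries k o (i + 1) j) = finrank k (unorientedChain k o i j) := by
  have h₁ := finrank_quotient_submoduleOf (boundaries_le_cycles k o i j)
  have h₂ := finrank_map_add_finrank_ker_inf (differential k o) (unorientedChain k o i j)
  have h₃ : boundaries k o (i + 1) j =
      (unorientedChain k o i j).map (differential k o) := by
    rw [boundaries, add_sub_cancel_right]
  rw [h₃, ← h₂]
  change _ = _ + finrank k (cycles k o i j)
  rw [← h₁]
  ring

end Ranks

/-! ### The graded Euler characteristic -/

section EulerCharacteristic

open Module

variable {D : VirtualDiagram} (k : Type*) [CommRing k] [IsDomain k]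

theorem negOnePow_add (r s : ℚ) : negOnePow (r + s) = negOnePow r * negOnePow s := by
  unfold negOnePow
  rw [← Complex.exp_add]
  congr 1
  push_cast
  ring

theorem negOnePow_one : negOnePow 1 = -1 := by
  unfold negOnePow
  rw [Rat.cast_one, mul_one, mul_comm, Complex.exp_pi_mul_I]

theorem negOnePow_add_one (r : ℚ) : negOnePow (r + 1) = -negOnePow r := by
  rw [negOnePow_add, negOnePow_one, mul_neg_one]

theorem qMon_add (z w : ℂ) (r : ℚ) : qMon (z + w) r = qMon z r + qMon w r :=
  AddMonoidAlgebra.single_add _ _ _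

theorem qMon_zero (r : ℚ) : qMon 0 r = 0 := AddMonoidAlgebra.single_zero _

theorem mem_halfIntegers_of_two_mul {r : ℚ} {n : ℤ} (h : 2 * r = n) : r ∈ halfIntegers :=
  AddSubgroup.mem_zmultiples_iff.2 ⟨n, by rw [zsmul_eq_mul]; linarith⟩

theorem homDegree_mem (o : D.Orientation) (s : D.EnhancedState) :
    homDegree o s ∈ halfIntegers :=
  mem_halfIntegers_of_two_mul (n := 2 * numB s.state - 2 * sMinus o - D.mixedNumber)
    (by unfold homDegree; push_cast; ring)

theorem quantumDegree_mem (o : D.Orientation) (s : D.EnhancedState) :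
    quantumDegree o s ∈ halfIntegers :=
  mem_halfIntegers_of_two_mul (n := 2 * s.qDegree + 2 * sPlus o - 4 * sMinus o - D.mixedNumber)
    (by unfold quantumDegree; push_cast; ring)

/-- The part of the Euler characteristic of a bigraded family of ranks in one homological degree. -/
def eulerRow (r : ℚ → ℚ → ℕ) (i : halfIntegers) : AddMonoidAlgebra ℂ ℚ :=
  ∑ᶠ j : halfIntegers, qMon (negOnePow i * (r i j : ℂ)) j

theorem finite_support_of_bound (o : D.Orientation) {r : ℚ → ℚ → ℕ} (d : ℚ)
    (h : ∀ i j, r i j ≠ 0 → ∃ s, homDegree o s = i + d ∧ quantumDegree o s = j) (i : ℚ) :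
    (Function.support fun j : halfIntegers => qMon (negOnePow i * (r i j : ℂ)) j).Finite := by
  refine (Set.finite_range fun s => (⟨quantumDegree o s, quantumDegree_mem o s⟩ :
    halfIntegers)).subset fun j hj => ?_
  have : r i j ≠ 0 := fun h0 => hj (by simp [h0, qMon_zero])
  obtain ⟨s, -, hs⟩ := h _ _ this
  exact ⟨s, Subtype.ext hs⟩

theorem finite_support_eulerRow (o : D.Orientation) {r : ℚ → ℚ → ℕ} (d : ℚ)
    (h : ∀ i j, r i j ≠ 0 → ∃ s, homDegree o s = i + d ∧ quantumDegree o s = j) :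
    (Function.support (eulerRow r)).Finite := by
  have hfin : (Set.range fun s => homDegree o s - d).Finite := Set.finite_range _
  refine (hfin.preimage (f := ((↑) : halfIntegers → ℚ)) Subtype.val_injective.injOn).subset
    fun i hi => ?_
  by_contra hne
  refine hi ?_
  unfold eulerRow
  rw [← finsum_zero (α := halfIntegers)]
  refine finsum_congr fun j => ?_
  have : r i j = 0 := by
    by_contra h0
    obtain ⟨s, hs, -⟩ := h _ _ h0
    exact hne ⟨s, by simp only [hs]; ring⟩
  simp [this, qMon_zero]

theorem exists_of_finrank_unorientedChain_ne_zero (o : D.Orientation) {i j : ℚ}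
    (h : finrank k (unorientedChain k o i j) ≠ 0) :
    ∃ s, homDegree o s = i ∧ quantumDegree o s = j := by
  rw [finrank_unorientedChain] at h
  obtain ⟨s, hs⟩ := Finset.card_ne_zero.1 h
  exact ⟨s, (Finset.mem_filter.1 hs).2⟩

/-- Telescoping: in degree i the chain rank exceeds the homology rank by the ranks of the boundaries
in degrees i and i + 1. Since (-1)^(i+1) = -(-1)^i, the two contributions cancel after a shift of
the summation index. -/
theorem gradedEulerChar_eq_finsum_chains (o : D.Orientation) : gradedEulerChar k o =
    ∑ᶠ i : halfIntegers, eulerRow (fun i j => finrank k (unorientedChain k o i j)) i := by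
  set h : ℚ → ℚ → ℕ := fun i j => finrank k (UnorientedKh k o i j) with hh
  set b : ℚ → ℚ → ℕ := fun i j => finrank k (boundaries k o i j) with hb
  set c : ℚ → ℚ → ℕ := fun i j => finrank k (unorientedChain k o i j) with hc
  have hrel : ∀ i j, h i j + b i j + b (i + 1) j = c i j := finrank_unorientedKh k o
  have sc : ∀ i j, c i j ≠ 0 → ∃ s, homDegree o s = i + 0 ∧ quantumDegree o s = j := by
    intro i j hij
    rw [add_zero]
    exact exists_of_finrank_unorientedChain_ne_zero k o hij
  have sh : ∀ i j, h i j ≠ 0 → ∃ s, homDegree o s = i + 0 ∧ quantumDegree o s = j := by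
    intro i j hij
    refine sc i j ?_
    have := hrel i j
    omega
  have sb : ∀ i j, b i j ≠ 0 → ∃ s, homDegree o s = i + 0 ∧ quantumDegree o s = j := by
    intro i j hij
    refine sc i j ?_
    have := hrel i j
    omega
  have sb' : ∀ i j, b (i + 1) j ≠ 0 → ∃ s, homDegree o s = i + 0 ∧ quantumDegree o s = j := by
    intro i j hij
    refine sc i j ?_
    have := hrel i j
    omega
  have one_mem : (1 : ℚ) ∈ halfIntegers := mem_halfIntegers_of_two_mul (n := 2) (by norm_num)
  let e : halfIntegers ≃ halfIntegers := Equiv.addRight ⟨1, one_mem⟩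
  have he : ∀ i, ((e i : halfIntegers) : ℚ) = (i : ℚ) + 1 := fun i => rfl
  have hrow : ∀ i : halfIntegers, eulerRow c i = eulerRow h i + (eulerRow b i - eulerRow b (e i)) := by
    intro i
    unfold eulerRow
    have fb' := finite_support_of_bound o (r := fun i j => b (i + 1) j) 0 sb' (i : ℚ)
    have e₁ : ∑ᶠ j : halfIntegers, qMon (negOnePow (e i : ℚ) * (b (e i) j : ℂ)) j =
        -∑ᶠ j : halfIntegers, qMon (negOnePow i * (b (i + 1) j : ℂ)) j := by
      rw [← finsum_neg_distrib]
      refine finsum_congr fun j => ?_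
      rw [he, negOnePow_add_one, neg_mul]
      exact AddMonoidAlgebra.single_neg _ _
    rw [e₁, sub_neg_eq_add,
      ← finsum_add_distrib (finite_support_of_bound o 0 sb (i : ℚ)) fb',
      ← finsum_add_distrib (finite_support_of_bound o 0 sh (i : ℚ))]
    · refine finsum_congr fun j => ?_
      rw [← qMon_add, ← qMon_add, ← hrel]
      push_cast
      congr 1
      ring
    · exact ((finite_support_of_bound o 0 sb (i : ℚ)).union fb').subset
        (Function.support_add _ _)
  have fb := finite_support_eulerRow o 0 sb
  have fb' : (Function.support fun i => eulerRow b (e i)).Finite :=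
    fb.preimage e.injective.injOn
  have hsum : ∑ᶠ i, eulerRow c i = ∑ᶠ i, eulerRow h i := by
    simp only [hrow]
    rw [finsum_add_distrib (finite_support_eulerRow o 0 sh), finsum_sub_distrib fb fb',
      finsum_comp_equiv e, sub_self, add_zero]
    exact (fb.union fb').subset (Function.support_sub _ _)
  rw [hsum]
  rfl

theorem gradedEulerChar_eq_sum (o : D.Orientation) : gradedEulerChar k o =
    ∑ s, qMon (negOnePow (homDegree o s)) (quantumDegree o s) := by
  rw [gradedEulerChar_eq_finsum_chains]
  have h₁ : ∀ i j : halfIntegers,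
      qMon (negOnePow i * (finrank k (unorientedChain k o i j) : ℂ)) j =
        ∑ s, if homDegree o s = i ∧ quantumDegree o s = j then
          qMon (negOnePow (homDegree o s)) (quantumDegree o s) else 0 := by
    intro i j
    rw [finrank_unorientedChain, ← Finset.sum_filter,
      Finset.sum_congr rfl (g := fun _ => qMon (negOnePow i) (j : ℚ)) fun s hs => by
        rw [(Finset.mem_filter.1 hs).2.1, (Finset.mem_filter.1 hs).2.2],
      Finset.sum_const, qMon, qMon, AddMonoidAlgebra.smul_single, nsmul_eq_mul, mul_comm]
  unfold eulerRow
  have h₂ : ∀ i : halfIntegers, ∑ᶠ j : halfIntegers,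
      qMon (negOnePow i * (finrank k (unorientedChain k o i j) : ℂ)) j =
        ∑ s, if homDegree o s = i then
          qMon (negOnePow (homDegree o s)) (quantumDegree o s) else 0 := by
    intro i
    simp only [h₁]
    rw [finsum_sum_comm]
    · refine Finset.sum_congr rfl fun s _ => ?_
      rw [finsum_eq_single _ ⟨quantumDegree o s, quantumDegree_mem o s⟩]
      · simp
      · intro j hj
        rw [if_neg]
        rintro ⟨-, h⟩
        exact hj (Subtype.ext h.symm)
    · intro s _
      refine (Set.finite_singleton
        (⟨quantumDegree o s, quantumDegree_mem o s⟩ : halfIntegers)).subset fun j hj => ?_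
      by_contra hne
      refine hj (if_neg ?_)
      rintro ⟨-, h⟩
      exact hne (Subtype.ext h.symm)
  simp only [h₂]
  rw [finsum_sum_comm]
  · refine Finset.sum_congr rfl fun s _ => ?_
    rw [finsum_eq_single _ ⟨homDegree o s, homDegree_mem o s⟩]
    · simp
    · intro j hj
      rw [if_neg]
      intro h
      exact hj (Subtype.ext h.symm)
  · intro s _
    refine (Set.finite_singleton
      (⟨homDegree o s, homDegree_mem o s⟩ : halfIntegers)).subset fun j hj => ?_
    by_contra hne
    refine hj (if_neg ?_)
    intro h
    exact hne (Subtype.ext h.symm)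

end EulerCharacteristic

/-! ### Cores -/

section Cores

variable {D : VirtualDiagram}

theorem deleteOdd_subset (S : Finset (Fin D.N)) : D.deleteOdd S ⊆ S :=
  Finset.filter_subset _ _

theorem iterate_deleteOdd_subset (S : Finset (Fin D.N)) (m : ℕ) : D.deleteOdd^[m] S ⊆ S := by
  induction m with
  | zero => exact Finset.Subset.refl _
  | succ m ih =>
    rw [Function.iterate_succ_apply']
    exact (deleteOdd_subset _).trans ih

theorem core_subset (S : Finset (Fin D.N)) : D.core S ⊆ S :=
  iterate_deleteOdd_subset S _

/-- As long as the process has not stabilized, each round has removed a component; after `S.card`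
rounds the sub-link is stable or empty, and the empty one is stable. -/
theorem deleteOdd_core (S : Finset (Fin D.N)) : D.deleteOdd (D.core S) = D.core S := by
  have key : ∀ m, D.deleteOdd (D.deleteOdd^[m] S) = D.deleteOdd^[m] S ∨
      (D.deleteOdd^[m] S).card + m ≤ S.card := by
    intro m
    induction m with
    | zero => exact Or.inr le_rfl
    | succ m ih =>
      rw [Function.iterate_succ_apply']
      by_cases h : D.deleteOdd (D.deleteOdd^[m] S) = D.deleteOdd^[m] S
      · exact Or.inl (by rw [h, h])
      · right
        have h₁ := ih.resolve_left h
        have h₂ := Finset.card_lt_card ((deleteOdd_subset _).ssubset_of_ne h)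
        omega
  rcases key S.card with h | h
  · exact h
  · have : D.deleteOdd^[S.card] S = ∅ := by
      rw [← Finset.card_eq_zero]
      omega
    rw [core, this]
    rfl

theorem even_sum_core {S : Finset (Fin D.N)} {i : Fin D.N} (h : i ∈ D.core S) :
    Even (∑ j ∈ (D.core S).erase i, (D.crossingsBetween i j).card) := by
  rw [← deleteOdd_core, deleteOdd, Finset.mem_filter] at h
  exact h.2

theorem mantle_succ (r : ℕ) : D.mantle (r + 1) = D.mantle r \ D.core (D.mantle r) := by
  rw [mantle, Function.iterate_succ_apply']
  rfl

theorem mantle_antitone : Antitone D.mantle :=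
  antitone_nat_of_succ_le fun r => by
    rw [mantle_succ]
    exact Finset.sdiff_subset

theorem core_mantle_subset_components (r : ℕ) : D.core (D.mantle r) ⊆ D.components :=
  (core_subset _).trans (mantle_antitone (Nat.zero_le r))

theorem eq_of_mem_core_of_mem_core {i : Fin D.N} {r r' : ℕ} (h : i ∈ D.core (D.mantle r))
    (h' : i ∈ D.core (D.mantle r')) : r = r' := by
  have key : ∀ {r r'}, i ∈ D.core (D.mantle r) → i ∈ D.core (D.mantle r') → ¬ r < r' := by
    intro r r' h h' hlt
    have := mantle_antitone (Nat.succ_le_of_lt hlt) (core_subset _ h')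
    rw [Nat.succ_eq_add_one, mantle_succ, Finset.mem_sdiff] at this
    exact this.2 h
  exact le_antisymm (not_lt.1 (key h' h)) (not_lt.1 (key h h'))

theorem crossingsBetween_comm (i j : Fin D.N) :
    D.crossingsBetween i j = D.crossingsBetween j i := by
  unfold crossingsBetween
  simp only [or_comm]

/-- The number modulo 2 of crossings between two components if these lie in the same core. -/
def coreCrossings (i j : Fin D.N) : ZMod 2 :=
  if D.coreParity i j = 0 then ((D.crossingsBetween i j).card : ZMod 2) else 0

theorem coreParity_eq_zero_iff (i j : Fin D.N) : D.coreParity i j = 0 ↔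
    ∃ r, i ∈ D.core (D.mantle r) ∧ j ∈ D.core (D.mantle r) := by
  unfold coreParity
  split_ifs with h <;> simp [h]

theorem coreParity_eq_zero_or_one (i j : Fin D.N) : D.coreParity i j = 0 ∨ D.coreParity i j = 1 := by
  unfold coreParity
  split_ifs <;> simp

theorem coreCrossings_comm (i j : Fin D.N) : coreCrossings i j = coreCrossings j i := by
  unfold coreCrossings
  simp only [coreParity_eq_zero_iff, and_comm, crossingsBetween_comm i j]

/-- Different cores are disjoint, so only the core containing i contributes, and in it every
component has an even number of mixed crossings. -/
theorem sum_coreCrossings (i : Fin D.N) :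
    ∑ j ∈ D.components.erase i, coreCrossings i j = 0 := by
  by_cases h : ∃ r, i ∈ D.core (D.mantle r)
  · obtain ⟨r, hr⟩ := h
    have e : ∀ j, D.coreParity i j = 0 ↔ j ∈ D.core (D.mantle r) := by
      intro j
      rw [coreParity_eq_zero_iff]
      constructor
      · rintro ⟨r', h₁, h₂⟩
        rwa [eq_of_mem_core_of_mem_core hr h₁]
      · exact fun h => ⟨r, hr, h⟩
    have hsub : (D.core (D.mantle r)).erase i ⊆ D.components.erase i :=
      Finset.erase_subset_erase _ (core_mantle_subset_components r)
    rw [← Finset.sum_subset hsub]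
    · rw [Finset.sum_congr rfl (f := coreCrossings i)
          (g := fun j => ((D.crossingsBetween i j).card : ZMod 2))
        fun j hj => if_pos ((e j).2 (Finset.mem_of_mem_erase hj)), ← Nat.cast_sum]
      exact (ZMod.natCast_eq_zero_iff_even).2 (even_sum_core hr)
    · intro j hj hj'
      refine if_neg fun h => hj' ?_
      exact Finset.mem_erase.2 ⟨(Finset.mem_erase.1 hj).1, (e j).1 h⟩
  · refine Finset.sum_eq_zero fun j _ => if_neg fun h' => h ?_
    obtain ⟨r, hr, -⟩ := (coreParity_eq_zero_iff i j).1 h'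
    exact ⟨r, hr⟩

/-- By symmetry the sum over pairs equals the sum over i of x i times the full row sum of w. -/
theorem sum_lt_eq_zero_of_symmetric {I A : Type*} [LinearOrder I] [CommRing A] (S : Finset I)
    (x : I → A) (w : I → I → A) (hw : ∀ i j, w i j = w j i)
    (h : ∀ i ∈ S, ∑ j ∈ S.erase i, w i j = 0) :
    ∑ i ∈ S, ∑ j ∈ S.filter (fun j => i < j), (x i + x j) * w i j = 0 := by
  have e₁ : ∑ i ∈ S, ∑ j ∈ S.filter (fun j => i < j), x j * w i j =
      ∑ i ∈ S, ∑ j ∈ S.filter (fun j => j < i), x i * w i j := by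
    rw [Finset.sum_comm' (t' := S) (s' := fun j => S.filter fun i => i < j)
      (by intro i j; simp only [Finset.mem_filter]; tauto)]
    exact Finset.sum_congr rfl fun i _ => Finset.sum_congr rfl fun j _ => by rw [hw]
  simp only [add_mul, Finset.sum_add_distrib]
  rw [e₁, ← Finset.sum_add_distrib]
  refine Finset.sum_eq_zero fun i hi => ?_
  rw [← Finset.mul_sum, ← Finset.mul_sum, ← mul_add, ← Finset.sum_union, ← mul_zero (x i), ← h i hi]
  · congr 2
    ext j
    simp only [Finset.mem_union, Finset.mem_filter, Finset.mem_erase]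
    constructor
    · rintro (⟨h₁, h₂⟩ | ⟨h₁, h₂⟩)
      · exact ⟨h₂.ne', h₁⟩
      · exact ⟨h₂.ne, h₁⟩
    · rintro ⟨h₁, h₂⟩
      rcases lt_or_gt_of_ne h₁ with h₃ | h₃
      · exact Or.inr ⟨h₂, h₃⟩
      · exact Or.inl ⟨h₂, h₃⟩
  · rw [Finset.disjoint_filter]
    intro j _ h₁ h₂
    exact absurd h₁ h₂.not_gt

end Cores

/-! ### Change of orientation -/

section Reorientation

variable {D : VirtualDiagram} (o o' : D.Orientation)

/-- The component of the arc `a` has different orientations in `o` and `o'`. -/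
def IsReversed (a : Fin D.N) : Prop := ∃ c p, D.arc c p = a ∧ o.inward c p ≠ o'.inward c p

variable {o o'}

theorem isReversed_arc_iff (c : Fin D.n) (p : Fin 4) :
    IsReversed o o' (D.arc c p) ↔ o.inward c p ≠ o'.inward c p := by
  constructor
  · rintro ⟨c', p', h, hne⟩
    by_cases e : (c', p') = (c, p)
    · obtain ⟨rfl, rfl⟩ := Prod.mk.inj e
      exact hne
    · have h₁ := o.coherent c' p' c p h e
      have h₂ := o'.coherent c' p' c p h e
      rw [h₁, h₂]
      simpa using hne
  · exact fun h => ⟨c, p, rfl, h⟩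

theorem isReversed_iff_of_sameComponent {a b : Fin D.N} (h : D.SameComponent a b) :
    IsReversed o o' a ↔ IsReversed o o' b := by
  induction h with
  | rel x y h =>
    obtain ⟨c, p, rfl, rfl⟩ := h
    rw [isReversed_arc_iff, isReversed_arc_iff, o.straight, o'.straight]
    simp
  | refl x => rfl
  | symm x y _ ih => exact ih.symm
  | trans x y z _ _ ih₁ ih₂ => exact ih₁.trans ih₂

variable (o o') in
/-- The sign by which the orientations `o` and `o'` of the component of an arc differ. -/
def reversalSign (a : Fin D.N) : ℤ := if IsReversed o o' a then -1 else 1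

theorem reversalSign_eq_of_sameComponent {a b : Fin D.N} (h : D.SameComponent a b) :
    reversalSign o o' a = reversalSign o o' b := by
  unfold reversalSign
  rw [if_congr (isReversed_iff_of_sameComponent h) rfl rfl]

theorem crossingSign_eq (c : Fin D.n) : crossingSign o c =
    reversalSign o o' (D.arc c 0) * reversalSign o o' (D.arc c 1) * crossingSign o' c := by
  have h13 : D.SameComponent (D.arc c 1) (D.arc c 3) := Relation.EqvGen.rel _ _ ⟨c, 1, rfl, rfl⟩
  rw [reversalSign_eq_of_sameComponent h13]
  unfold reversalSign crossingSign
  rw [if_congr (isReversed_arc_iff c 0) rfl rfl, if_congr (isReversed_arc_iff c 3) rfl rfl]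
  cases o.inward c 0 <;> cases o.inward c 3 <;> cases o'.inward c 0 <;> cases o'.inward c 3 <;> rfl

theorem reversalSign_mul_self (a : Fin D.N) :
    reversalSign o o' a * reversalSign o o' a = 1 := by
  unfold reversalSign; split_ifs <;> rfl

variable (o o')

theorem crossingSign_eq_of_isSelf {c : Fin D.n} (h : D.IsSelf c) :
    crossingSign o c = crossingSign o' c := by
  rw [crossingSign_eq (o := o) (o' := o'), ← reversalSign_eq_of_sameComponent h,
    reversalSign_mul_self, one_mul]

theorem sPlus_eq : sPlus o = sPlus o' := by
  unfold sPlus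
  congr 1
  refine Finset.filter_congr fun c _ => and_congr_right fun h => ?_
  rw [crossingSign_eq_of_isSelf o o' h]

theorem sMinus_eq : sMinus o = sMinus o' := by
  unfold sMinus
  congr 1
  refine Finset.filter_congr fun c _ => and_congr_right fun h => ?_
  rw [crossingSign_eq_of_isSelf o o' h]

/-- Twice the linking number. -/
def signSum (i j : Fin D.N) : ℤ := ∑ c ∈ D.crossingsBetween i j, crossingSign o c

theorem linking_eq (i j : Fin D.N) : linking o i j = (signSum o i j : ℚ) / 2 := by
  unfold linking signSum
  push_cast
  rfl

theorem signSum_eq (i j : Fin D.N) :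
    signSum o i j = reversalSign o o' i * reversalSign o o' j * signSum o' i j := by
  unfold signSum
  rw [Finset.mul_sum]
  refine Finset.sum_congr rfl fun c hc => ?_
  rw [crossingSign_eq (o := o) (o' := o')]
  rcases (Finset.mem_filter.1 hc).2 with ⟨h₁, h₂⟩ | ⟨h₁, h₂⟩ <;>
    rw [reversalSign_eq_of_sameComponent h₁, reversalSign_eq_of_sameComponent h₂]
  ring

theorem signSum_cast (i j : Fin D.N) :
    (signSum o i j : ZMod 2) = ((D.crossingsBetween i j).card : ZMod 2) := by
  have : ∀ c, ((crossingSign o c : ℤ) : ZMod 2) = 1 := by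
    intro c
    unfold crossingSign
    split_ifs <;> decide
  unfold signSum
  simp [this]

theorem exists_signSum_add_pairParity (i j : Fin D.N) :
    ∃ m : ℤ, signSum o i j + (D.pairParity i j : ℤ) = 2 * m := by
  have : ((signSum o i j + (D.pairParity i j : ℤ) : ℤ) : ZMod 2) = 0 := by
    rw [Int.cast_add, signSum_cast, pairParity, Int.cast_natCast, ZMod.natCast_mod]
    exact CharTwo.add_self_eq_zero _
  obtain ⟨m, hm⟩ := (ZMod.intCast_zmod_eq_zero_iff_dvd _ 2).1 this
  exact ⟨m, by exact_mod_cast hm⟩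

theorem floor_linking {i j : Fin D.N} {m : ℤ}
    (h : signSum o i j + (D.pairParity i j : ℤ) = 2 * m) :
    ⌊linking o i j + (D.pairParity i j : ℚ) / 2⌋ = m := by
  have h' : (signSum o i j : ℚ) + (D.pairParity i j : ℚ) = 2 * m := by exact_mod_cast h
  rw [linking_eq, ← add_div, h', mul_div_cancel_left₀ _ (two_ne_zero), Int.floor_intCast]

theorem neg_one_zpow_cases (n : ℤ) : (-1 : ℚ) ^ n = 1 ∨ (-1 : ℚ) ^ n = -1 :=
  (Int.even_or_odd n).imp Even.neg_one_zpow Odd.neg_one_zpow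

theorem lambdaTilde_mem_halfIntegers : lambdaTilde o ∈ halfIntegers := by
  refine AddSubgroup.sum_mem _ fun i _ => AddSubgroup.sum_mem _ fun j _ => ?_
  have h : linking o i j ∈ halfIntegers :=
    mem_halfIntegers_of_two_mul (n := signSum o i j) (by rw [linking_eq]; ring)
  rw [modifiedLinking]
  rcases neg_one_zpow_cases (D.coreParity i j * ⌊linking o i j + (D.pairParity i j : ℚ) / 2⌋)
    with e | e <;> rw [e]
  · rwa [one_mul]
  · rw [neg_one_mul]
    exact AddSubgroup.neg_mem _ h

/-- Only a pair with exactly one reversed component changes, and its linking number is negated. If p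
= 0 the change is ±2 Lk, congruent to the number of crossings. If p = 1 and π = 0 then Lk is an
integer and the change is ±2 Lk, which is even; if p = 1 and π = 1 the sign in front flips along
with Lk and nothing changes. -/
theorem exists_modifiedLinking_sub (i j : Fin D.N) : ∃ z : ℤ,
    modifiedLinking o i j - modifiedLinking o' i j = z ∧ (z : ZMod 2) =
      ((if IsReversed o o' i then 1 else 0) + (if IsReversed o o' j then 1 else 0)) *
        coreCrossings i j := by
  have hS := signSum_eq o o' i j
  have same : signSum o i j = signSum o' i j →
      modifiedLinking o i j - modifiedLinking o' i j = ((0 : ℤ) : ℚ) := by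
    intro h
    simp only [modifiedLinking, linking_eq, h, sub_self, Int.cast_zero]
  have opp : signSum o i j = -signSum o' i j → ∃ z : ℤ,
      modifiedLinking o i j - modifiedLinking o' i j = z ∧ (z : ZMod 2) = coreCrossings i j := by
    intro h
    rcases coreParity_eq_zero_or_one i j with hp | hp
    · refine ⟨-signSum o' i j, ?_, ?_⟩
      · simp only [modifiedLinking, hp, zero_mul, zpow_zero, one_mul, linking_eq, h]
        push_cast
        ring
      · rw [coreCrossings, if_pos hp, Int.cast_neg, signSum_cast, ZMod.neg_eq_self_mod_two]
    · have hw : coreCrossings i j = 0 := by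
        rw [coreCrossings, if_neg]
        rw [hp]
        exact one_ne_zero
      rw [hw]
      obtain ⟨m, hm⟩ := exists_signSum_add_pairParity o' i j
      -- Negating Lk turns the exponent m = Lk + π/2 into π - m.
      have hm' : signSum o i j + (D.pairParity i j : ℤ) = 2 * ((D.pairParity i j : ℤ) - m) := by
        rw [h]; linarith
      have f₁ := floor_linking o' hm
      have f₂ := floor_linking o hm'
      simp only [modifiedLinking, hp, one_mul, f₁, f₂]
      rw [linking_eq, linking_eq, h]
      have hπ : D.pairParity i j = 0 ∨ D.pairParity i j = 1 := by
        unfold pairParity; omega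
      rcases hπ with hπ | hπ <;> rw [hπ] at hm ⊢
      · have e : signSum o' i j = 2 * m := by simpa using hm
        rw [e]
        have e' : (-1 : ℚ) ^ (((0 : ℕ) : ℤ) - m) = (-1 : ℚ) ^ m := by
          rw [Nat.cast_zero, zero_sub, zpow_neg, ← inv_zpow, inv_neg_one]
        rw [e']
        rcases neg_one_zpow_cases m with e₂ | e₂ <;> rw [e₂]
        · refine ⟨-(2 * m), by push_cast; ring, ?_⟩
          push_cast
          rw [show (2 : ZMod 2) = 0 from rfl, zero_mul, neg_zero]
        · refine ⟨2 * m, by push_cast; ring, ?_⟩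
          push_cast
          rw [show (2 : ZMod 2) = 0 from rfl, zero_mul]
      · have e' : (-1 : ℚ) ^ (((1 : ℕ) : ℤ) - m) = -(-1 : ℚ) ^ m := by
          rw [Nat.cast_one, zpow_sub₀ (by norm_num), zpow_one, div_eq_mul_inv, ← zpow_neg,
            zpow_neg, ← inv_zpow, inv_neg_one, neg_one_mul]
        rw [e']
        exact ⟨0, by push_cast; ring, by simp⟩
  by_cases hi : IsReversed o o' i <;> by_cases hj : IsReversed o o' j <;>
    simp only [reversalSign, hi, hj, if_true, if_false] at hS ⊢
  · exact ⟨0, same (by simpa using hS), by rw [CharTwo.add_self_eq_zero]; simp⟩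
  · simpa using opp (by simpa using hS)
  · simpa using opp (by simpa using hS)
  · exact ⟨0, same (by simpa using hS), by simp⟩

theorem negOnePow_two_mul (n : ℤ) : negOnePow (2 * n) = 1 := by
  unfold negOnePow
  rw [Complex.exp_eq_one_iff]
  exact ⟨n, by push_cast; ring⟩

theorem negOnePow_lambdaTilde_eq : negOnePow (lambdaTilde o) = negOnePow (lambdaTilde o') := by
  choose z hz₁ hz₂ using exists_modifiedLinking_sub o o'
  have h₁ : lambdaTilde o - lambdaTilde o' =
      ((∑ i ∈ D.components, ∑ j ∈ D.components.filter (fun j => i < j), z i j : ℤ) : ℚ) := by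
    unfold lambdaTilde
    push_cast
    simp only [← hz₁, Finset.sum_sub_distrib]
  have h₂ : ((∑ i ∈ D.components, ∑ j ∈ D.components.filter (fun j => i < j), z i j : ℤ) :
      ZMod 2) = 0 := by
    push_cast
    simp only [hz₂]
    exact sum_lt_eq_zero_of_symmetric D.components
      (fun i => if IsReversed o o' i then 1 else 0) coreCrossings coreCrossings_comm
      fun i _ => sum_coreCrossings i
  obtain ⟨n, hn⟩ := (ZMod.intCast_zmod_eq_zero_iff_dvd _ 2).1 h₂
  rw [hn] at h₁
  have : lambdaTilde o = lambdaTilde o' + 2 * n := by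
    push_cast at h₁
    linarith
  rw [this, negOnePow_add, negOnePow_two_mul, mul_one]

end Reorientation

/-! ### The bracket polynomial as a sum over enhanced states -/

section Bracket

variable {D : VirtualDiagram}

theorem qMon_mul_qMon (z w : ℂ) (r s : ℚ) : qMon z r * qMon w s = qMon (z * w) (r + s) :=
  AddMonoidAlgebra.single_mul_single _ _ _ _

theorem prod_qMon {I : Type*} (S : Finset I) (r : I → ℚ) :
    ∏ a ∈ S, qMon 1 (r a) = qMon 1 (∑ a ∈ S, r a) := by
  induction S using Finset.induction_on with
  | empty => simp [qMon, AddMonoidAlgebra.one_def]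
  | insert a S ha ih => rw [Finset.prod_insert ha, Finset.sum_insert ha, ih, qMon_mul_qMon, one_mul]

theorem neg_qMon_pow (m : ℕ) : (-qMon 1 1) ^ m = qMon ((-1) ^ m) m := by
  induction m with
  | zero => simp [qMon, AddMonoidAlgebra.one_def]
  | succ m ih =>
    have : -qMon 1 1 = qMon (-1) 1 := (AddMonoidAlgebra.single_neg _ _).symm
    rw [pow_succ, ih, this, qMon_mul_qMon, pow_succ, Nat.cast_succ]

/-- The enhanced state in which the circles of `σ` with names in `T` are labelled `x`. -/
def labelledState (σ : Fin D.n → Bool) (T : Finset (Fin D.N)) : D.EnhancedState where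
  state := σ
  label a := decide (D.circleOf σ a ∈ T)
  label_eq c p := by rw [circleOf_partner]

theorem sum_states_eq (σ : Fin D.n → Bool) :
    ∑ s ∈ Finset.univ.filter (fun s : D.EnhancedState => s.state = σ),
      qMon ((-1) ^ numB (D := D) s.state) (s.qDegree : ℚ) =
    (-qMon 1 1) ^ numB (D := D) σ * (qMon 1 (-1) + qMon 1 1) ^ (D.circles σ).card := by
  -- Expanding the power, the subset of factors contributing q⁻¹ is the set of circles labelled x.
  rw [← Finset.prod_const, Finset.prod_add, Finset.mul_sum]
  refine Finset.sum_nbij' (fun s => (D.circles σ).filter fun a => s.label a = true)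
    (fun T => labelledState σ T) ?_ ?_ ?_ ?_ ?_
  · intro s _
    exact Finset.mem_powerset.2 (Finset.filter_subset _ _)
  · intro T _
    simp [labelledState]
  · intro s hs
    obtain rfl := (Finset.mem_filter.1 hs).2
    refine EnhancedState.ext_of rfl fun a => ?_
    rw [s.label_eq_of (sameCircle_circleOf s.state a)]
    simp [labelledState, circleOf_mem_circles]
  · intro T hT
    rw [Finset.mem_powerset] at hT
    ext a
    simp only [labelledState, Finset.mem_filter, decide_eq_true_eq]
    constructor
    · rintro ⟨h₁, h₂⟩
      rwa [mem_circles_iff.1 h₁] at h₂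
    · intro h
      exact ⟨hT h, by rwa [mem_circles_iff.1 (hT h)]⟩
  · intro s hs
    obtain rfl := (Finset.mem_filter.1 hs).2
    have e : D.circles s.state \ (D.circles s.state).filter (fun a => s.label a = true) =
        (D.circles s.state).filter fun a => ¬ s.label a = true := by
      ext a
      simp only [Finset.mem_sdiff, Finset.mem_filter]
      tauto
    rw [neg_qMon_pow, e, prod_qMon _ (fun _ => (-1 : ℚ)), prod_qMon _ (fun _ => (1 : ℚ)),
      qMon_mul_qMon, qMon_mul_qMon, ← Finset.sum_ite, EnhancedState.qDegree]
    push_cast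
    simp

theorem bracket_eq_sum :
    D.bracket = ∑ s : D.EnhancedState, qMon ((-1) ^ numB (D := D) s.state) (s.qDegree : ℚ) := by
  rw [bracket, ← Finset.sum_fiberwise Finset.univ (fun s : D.EnhancedState => s.state)]
  exact Finset.sum_congr rfl fun σ _ => (sum_states_eq σ).symm

theorem negOnePow_natCast_add (m : ℕ) (r : ℚ) :
    negOnePow (m + r) = (-1) ^ m * negOnePow r := by
  induction m with
  | zero => simp
  | succ m ih =>
    rw [Nat.cast_succ, add_right_comm, negOnePow_add_one, ih, pow_succ]
    ring

/-- The two sides agree term by term over enhanced states, since the exponents in the prefactor are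
the degree shifts. The three orientations may differ because s₊, s₋ and (-1)^λ̃ do not depend on
them. -/
theorem unorientedJones_eq_smul_gradedEulerChar (k : Type*) [CommRing k] [IsDomain k]
    (o o₁ o₂ : D.Orientation) : unorientedJones o =
      negOnePow (lambdaTilde o₁) • gradedEulerChar k o₂ := by
  rw [unorientedJones, gradedEulerChar_eq_sum, bracket_eq_sum, Finset.mul_sum, Finset.smul_sum,
    sPlus_eq o o₂, sMinus_eq o o₂]
  refine Finset.sum_congr rfl fun s _ => ?_
  rw [qMon_mul_qMon, homDegree, quantumDegree, negOnePow_natCast_add, sub_sub, sub_eq_add_neg,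
    negOnePow_add, negOnePow_lambdaTilde_eq o o₁, neg_add, ← sub_eq_add_neg, qMon, qMon,
    AddMonoidAlgebra.smul_single, smul_eq_mul]
  congr 1
  · ring
  · ring

end Bracket

end

end VirtualDiagram

/-! ### The Euler characteristic formula with independent orientations -/

theorem mainTheorem7 (k : Type*) [CommRing k] [IsDomain k] (D : VirtualDiagram)
    (o o₁ o₂ : D.Orientation) :
    VirtualDiagram.lambdaTilde o₁ ∈ VirtualDiagram.halfIntegers ∧
    VirtualDiagram.differential k o₂ ∘ₗ VirtualDiagram.differential k o₂ = 0 ∧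
    (∀ i j : ℚ, (VirtualDiagram.unorientedChain k o₂ i j).map (VirtualDiagram.differential k o₂) ≤
      VirtualDiagram.unorientedChain k o₂ (i + 1) j) ∧
    VirtualDiagram.unorientedJones o =
      VirtualDiagram.negOnePow (VirtualDiagram.lambdaTilde o₁) •
        VirtualDiagram.gradedEulerChar k o₂ :=
  ⟨VirtualDiagram.lambdaTilde_mem_halfIntegers o₁,
    VirtualDiagram.differential_comp_differential k o₂,
    VirtualDiagram.map_unorientedChain_le k o₂,
    VirtualDiagram.unorientedJones_eq_smul_gradedEulerChar k o o₁ o₂⟩
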